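/- Let $G$ be a simply connected solvable real Lie group of dimension $8$ whose Lie algebra is quasi-abelian (it contains an abelian ideal of codimension $1$), let $\Gamma\subset G$ be a discrete subgroup acting on $G$ by left translations, and suppose that the quotient manifold $M=\Gamma\backslash G$ is compact (a quasi-abelian solvmanifold), with projection $\pi\colon G\to M$. A $\mathrm{Spin}(7)$ structure on $M$ is a Riemannian metric $g$ together with a smooth $4$-form $\Omega$ such that each tangent space $T_pM$ has a $g$-orthonormal basis $(e_0,\dots,e_7)$ (a Cayley frame) with dual basis $(e^0,\dots,e^7)$ in which, writing $e^{ijkl}=e^i\wedge e^j\wedge e^k\wedge e^l$, $$\Omega_p=e^{0123}-e^{0145}-e^{0167}-e^{0246}+e^{0257}-e^{0347}-e^{0356}+e^{4567}-e^{2367}-e^{2345}-e^{1357}+e^{1346}-e^{1256}-e^{1247};$$ $M$ is oriented by the Cayley frames, and $*$ is the Hodge star of $g$ and this orientation. The structure is invariant if $\pi^*g$ and $\pi^*\Omega$ are left-invariant on $G$. It is parallel if $*d\Omega=0$, and locally conformally parallel if at each point $p$ there is $w\in T_pM$ with $(*d\Omega)_p=i(w)\Omega_p$ (that is, $*d\Omega\in\Lambda^3_8T^*M$).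 Then $M$ carries no invariant $\mathrm{Spin}(7)$ structure that is locally conformally parallel and not parallel. -/

import Mathlib

open scoped Manifold ContDiff Topology

noncomputable section

/-! ### Differential forms on `8`-manifolds -/

/-- The model space `ℝ⁸`. -/
abbrev R8 : Type := EuclideanSpace ℝ (Fin 8)

/-- A (not necessarily smooth) differential `k`-form on an `8`-manifold. -/
abbrev DiffForm (M : Type*) [TopologicalSpace M] [ChartedSpace R8 M] (k : ℕ) : Type _ :=
  ∀ x : M, TangentSpace 𝓘(ℝ, R8) x [⋀^Fin k]→L[ℝ] ℝ

namespace DiffForm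

variable {M N : Type*} [TopologicalSpace M] [ChartedSpace R8 M]
  [TopologicalSpace N] [ChartedSpace R8 N] {k : ℕ}

/-- The pullback `f^* α` of a differential form along a map `f`. -/
def pullback (f : N → M) (α : DiffForm M k) : DiffForm N k := fun x =>
  (α (f x)).compContinuousLinearMap (mfderiv 𝓘(ℝ, R8) 𝓘(ℝ, R8) f x)

/-- The form `α` read in the preferred chart at `p`, a form on the (open) target of the chart. -/
def inChart (α : DiffForm M k) (p : M) (y : R8) : R8 [⋀^Fin k]→L[ℝ] ℝ :=
  (α ((extChartAt 𝓘(ℝ, R8) p).symm y)).compContinuousLinearMap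
    (mfderiv 𝓘(ℝ, R8) 𝓘(ℝ, R8) (extChartAt 𝓘(ℝ, R8) p).symm y)

/-- A form is smooth if it is smooth in charts. -/
def IsSmooth (α : DiffForm M k) : Prop :=
  ∀ p : M, ContDiffOn ℝ ∞ (α.inChart p) (extChartAt 𝓘(ℝ, R8) p).target

/-- The exterior derivative of a form, computed at `p` in the preferred chart at `p`. -/
def d (α : DiffForm M k) : DiffForm M (k + 1) := fun p =>
  (extDeriv (α.inChart p) (extChartAt 𝓘(ℝ, R8) p p)).compContinuousLinearMap
    (mfderiv 𝓘(ℝ, R8) 𝓘(ℝ, R8) (extChartAt 𝓘(ℝ, R8) p) p)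

end DiffForm

/-! ### Linear algebra of `Spin(7)` structures -/

section Linear

variable {V : Type*} [AddCommGroup V] [Module ℝ V]

/-- The value of `e^{ijkl} = e^i ∧ e^j ∧ e^k ∧ e^l` at `v`, where `e^0, …, e^7` is the basis
dual to `e` and `I = (i, j, k, l)`. -/
def wedge4 (e : Module.Basis (Fin 8) ℝ V) (I : Fin 4 → Fin 8) (v : Fin 4 → V) : ℝ :=
  Matrix.det (Matrix.of fun r c : Fin 4 => e.coord (I r) (v c))

/-- The standard `Spin(7)` form in the basis `e`. -/
def cayleyForm (e : Module.Basis (Fin 8) ℝ V) (v : Fin 4 → V) : ℝ :=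
  wedge4 e ![0, 1, 2, 3] v - wedge4 e ![0, 1, 4, 5] v - wedge4 e ![0, 1, 6, 7] v
    - wedge4 e ![0, 2, 4, 6] v + wedge4 e ![0, 2, 5, 7] v - wedge4 e ![0, 3, 4, 7] v
    - wedge4 e ![0, 3, 5, 6] v
    + wedge4 e ![4, 5, 6, 7] v - wedge4 e ![2, 3, 6, 7] v - wedge4 e ![2, 3, 4, 5] v
    - wedge4 e ![1, 3, 5, 7] v + wedge4 e ![1, 3, 4, 6] v - wedge4 e ![1, 2, 5, 6] v
    - wedge4 e ![1, 2, 4, 7] v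

/-- The Hodge star `⋆β` of a `5`-form `β` on an oriented Euclidean space of dimension `8`, in
terms of a positively oriented orthonormal basis `e` (it does not depend on the choice of `e`):
`(⋆β)(v) = ∑_{s_0 < ⋯ < s_4} β(e_{s_0}, …, e_{s_4}) vol(e_{s_0}, …, e_{s_4}, v_0, v_1, v_2)`. -/
def hodgeStar5 (e : Module.Basis (Fin 8) ℝ V) (β : (Fin 5 → V) → ℝ) (v : Fin 3 → V) : ℝ :=
  ∑ s : Fin 5 ↪o Fin 8, β (fun i => e (s i)) * e.det (Fin.append (fun i => e (s i)) v)

end Linear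

/-! ### `Spin(7)` structures on manifolds -/

/-- A `Spin(7)` structure on an `8`-manifold: a Riemannian metric `g` and a smooth `4`-form `Ω`
such that around each point there are Cayley frames, i.e. `g`-orthonormal frames in which `Ω` is
the standard `Spin(7)` form. The manifold is oriented by the Cayley frames. -/
structure Spin7Structure (M : Type*) [TopologicalSpace M] [ChartedSpace R8 M]
    [IsManifold 𝓘(ℝ, R8) ∞ M] where
  /-- The Riemannian metric. -/
  metric : Bundle.ContMDiffRiemannianMetric 𝓘(ℝ, R8) ∞ R8
    (fun x : M => TangentSpace 𝓘(ℝ, R8) x)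
  /-- The `4`-form `Ω`. -/
  form : DiffForm M 4
  smooth_form : form.IsSmooth
  exists_cayley (p : M) : ∃ e : Module.Basis (Fin 8) ℝ (TangentSpace 𝓘(ℝ, R8) p),
    (∀ i j, metric.inner p (e i) (e j) = if i = j then 1 else 0) ∧
      ∀ v, form p v = cayleyForm e v

namespace Spin7Structure

variable {M : Type*} [TopologicalSpace M] [ChartedSpace R8 M] [IsManifold 𝓘(ℝ, R8) ∞ M]

/-- Cayley frames at the point `p`. -/
def IsCayleyFrame (S : Spin7Structure M) (p : M)
    (e : Module.Basis (Fin 8) ℝ (TangentSpace 𝓘(ℝ, R8) p)) : Prop :=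
  (∀ i j, S.metric.inner p (e i) (e j) = if i = j then 1 else 0) ∧
    ∀ v, S.form p v = cayleyForm e v

/-- Parallel: `⋆dΩ = 0`. -/
def IsParallel (S : Spin7Structure M) : Prop :=
  ∀ p e, S.IsCayleyFrame p e → ∀ v, hodgeStar5 e (S.form.d p) v = 0

/-- Locally conformally parallel: at each point, `⋆dΩ` lies in
`Λ³₈ = {i(w)Ω : w a tangent vector}`. -/
def IsLocallyConformallyParallel (S : Spin7Structure M) : Prop :=
  ∀ p e, S.IsCayleyFrame p e → ∃ w : TangentSpace 𝓘(ℝ, R8) p,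
    ∀ v, hodgeStar5 e (S.form.d p) v = S.form p (Matrix.vecCons w v)

/-- Given a Lie group `G` and a covering `π : G → M`, the structure is invariant if it is induced
by a left-invariant structure on `G`: the pullbacks to `G` of the metric and of the `4`-form are
left-invariant. -/
def IsInvariant {G : Type*} [TopologicalSpace G] [ChartedSpace R8 G] [Group G]
    (S : Spin7Structure M) (π : G → M) : Prop :=
  (∀ (a x : G) (u v : TangentSpace 𝓘(ℝ, R8) x),
    S.metric.inner (π (a * x))
        (mfderiv 𝓘(ℝ, R8) 𝓘(ℝ, R8) π (a * x) (mfderiv 𝓘(ℝ, R8) 𝓘(ℝ, R8) (a * ·) x u))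
        (mfderiv 𝓘(ℝ, R8) 𝓘(ℝ, R8) π (a * x) (mfderiv 𝓘(ℝ, R8) 𝓘(ℝ, R8) (a * ·) x v)) =
      S.metric.inner (π x) (mfderiv 𝓘(ℝ, R8) 𝓘(ℝ, R8) π x u)
        (mfderiv 𝓘(ℝ, R8) 𝓘(ℝ, R8) π x v)) ∧
  ∀ a : G, (S.form.pullback π).pullback (a * ·) = S.form.pullback π

end Spin7Structure

/-! ### Quasi-abelian solvmanifolds -/

/-- A Lie algebra is quasi-abelian if it contains an abelian ideal of codimension `1`. -/
def IsQuasiAbelian (L : Type*) [LieRing L] [LieAlgebra ℝ L] : Prop :=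
  ∃ 𝔥 : LieIdeal ℝ L, IsLieAbelian 𝔥 ∧ Module.finrank ℝ (L ⧸ 𝔥.toSubmodule) = 1

instance lieGroup_minSmoothness (G : Type*) [TopologicalSpace G] [ChartedSpace R8 G] [Group G]
    [LieGroup 𝓘(ℝ, R8) ∞ G] : LieGroup 𝓘(ℝ, R8) (minSmoothness ℝ 3) G :=
  LieGroup.of_le (n := ∞) (by
    simp only [minSmoothness_of_isRCLikeNormedField]
    exact ENat.LEInfty.out)

/-- `π` exhibits the manifold `M` as a solvmanifold: `M` is the compact quotient, with its quotient
smooth structure, of the simply connected solvable Lie group `G` by its discrete subgroup `Γ`,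
acting by left translations. -/
structure IsSolvmanifold {G : Type*} [TopologicalSpace G] [ChartedSpace R8 G] [Group G]
    {M : Type*} [TopologicalSpace M] [ChartedSpace R8 M] (Γ : Subgroup G) (π : G → M) : Prop where
  simplyConnected : SimplyConnectedSpace G
  solvable : Group.IsSolvable G
  discrete : DiscreteTopology Γ
  compact : CompactSpace M
  surjective : Function.Surjective π
  localDiffeo : IsLocalDiffeomorph 𝓘(ℝ, R8) 𝓘(ℝ, R8) ∞ π
  fibre : ∀ x y : G, π x = π y ↔ ∃ γ ∈ Γ, y = γ * x

end

/-! Left translation turns an invariant structure into one `4`-form Ω on the Lie algebra, and `d`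
into the Chevalley–Eilenberg differential (`toModel_d_apply`). The claim then becomes linear algebra
plus unimodularity.

Let `n` be a unit normal to the abelian ideal, η = n♭ and A = ad n. Then [u, v] = η(u)Av − η(v)Au,
so dΩ = η ∧ T with T = −A·Ω (`lieDiff_eq_wedgeOne`). A finite check of components shows that ⋆dΩ =
i(w)Ω means dΩ = w♭ ∧ Ω (`eq_wedgeOne_of_hodgeStar5_eq`). It remains to see that η ∧ T = w♭ ∧ Ω with
tr A = 0 forces w = 0 (`eq_zero_of_wedgeOne_derivForm_eq`). Contractions of Ω with itself are
multiples of the metric (constants 6, 42, 336), so pairings of A·Ω with Ω, and of i(n)(A·Ω) with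
i(n)Ω, are multiples of tr A and vanish. Pairing the equation with Ω first gives w ⊥ n. Then Q = ∑
T(w, ·)Ω(n, ·) is computed twice: contraction with Ω gives Q = −42|w|², contraction with i(n)Ω gives
Q = −24|w|². Hence w = 0.

The condition tr ad = 0 comes from the cocompact discrete subgroup. Right translations scale a
left-invariant volume by a factor |det Ad|, yet carry a fundamental domain of finite volume to
another one, so |det Ad| = 1 (`IsSolvmanifold.abs_det_adjoint_eq_one`). Differentiating at the
identity gives tr ad = 0 (`trace_ad_eq_zero`). -/

noncomputable section

/-! ### Components of the Cayley form and the duality between ⋆β and w♭ ∧ Ω. -/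

/-- The determinant of the `4 × 4` matrix with entries `δ_{I r, J c}`. -/
def deltaDet (I J : Fin 4 → Fin 8) : ℤ :=
  -- Laplace expansion over ℤ by nested conditionals, a form that the kernel evaluates quickly: `d2`
  -- and `d3` are the minors on the lower rows.
  let d2 := fun a b c d : Fin 4 => (if I a = J c then (if I b = J d then 1 else 0) else 0) -
    (if I a = J d then (if I b = J c then 1 else 0) else (0 : ℤ))
  let d3 := fun c d f : Fin 4 => (if I 1 = J c then d2 2 3 d f else 0) -
    (if I 1 = J d then d2 2 3 c f else 0) + (if I 1 = J f then d2 2 3 c d else 0)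
  (if I 0 = J 0 then d3 1 2 3 else 0) - (if I 0 = J 1 then d3 0 2 3 else 0) +
    (if I 0 = J 2 then d3 0 1 3 else 0) - (if I 0 = J 3 then d3 0 1 2 else 0)

lemma det_delta (I J : Fin 4 → Fin 8) :
    Matrix.det (Matrix.of fun r c : Fin 4 => if I r = J c then (1 : ℝ) else 0) =
      (deltaDet I J : ℝ) := by
  rw [Matrix.det_succ_row_zero]
  simp only [Matrix.det_fin_three, Fin.sum_univ_four, Matrix.submatrix_apply, Matrix.of_apply,
    deltaDet]
  simp only [show (Fin.succ 0 : Fin 4) = 1 from rfl, show (Fin.succ 1 : Fin 4) = 2 from rfl,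
    show (Fin.succ 2 : Fin 4) = 3 from rfl, Fin.succAbove_zero,
    show (1 : Fin 4).succAbove 0 = 0 from rfl, show (1 : Fin 4).succAbove 1 = 2 from rfl,
    show (1 : Fin 4).succAbove 2 = 3 from rfl, show (2 : Fin 4).succAbove 0 = 0 from rfl,
    show (2 : Fin 4).succAbove 1 = 1 from rfl, show (2 : Fin 4).succAbove 2 = 3 from rfl,
    show (3 : Fin 4).succAbove 0 = 0 from rfl, show (3 : Fin 4).succAbove 1 = 1 from rfl,
    show (3 : Fin 4).succAbove 2 = 2 from rfl, show ((0 : Fin 4) : ℕ) = 0 from rfl,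
    show ((1 : Fin 4) : ℕ) = 1 from rfl, show ((2 : Fin 4) : ℕ) = 2 from rfl,
    show ((3 : Fin 4) : ℕ) = 3 from rfl]
  have h : ∀ (p : Prop) [Decidable p] (x : ℤ), (if p then x else 0) = (if p then 1 else 0) * x :=
    fun p _ x => by split_ifs <;> simp
  simp only [h _ (_ + _), h _ (_ - _), h _ (ite _ _ _)]
  push_cast
  ring

/-- The components of the standard `Spin(7)` form. -/
def cayleyCoeff (J : Fin 4 → Fin 8) : ℤ :=
  deltaDet ![0, 1, 2, 3] J - deltaDet ![0, 1, 4, 5] J - deltaDet ![0, 1, 6, 7] J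
    - deltaDet ![0, 2, 4, 6] J + deltaDet ![0, 2, 5, 7] J - deltaDet ![0, 3, 4, 7] J
    - deltaDet ![0, 3, 5, 6] J
    + deltaDet ![4, 5, 6, 7] J - deltaDet ![2, 3, 6, 7] J - deltaDet ![2, 3, 4, 5] J
    - deltaDet ![1, 3, 5, 7] J + deltaDet ![1, 3, 4, 6] J - deltaDet ![1, 2, 5, 6] J
    - deltaDet ![1, 2, 4, 7] J

variable {V : Type*} [AddCommGroup V] [Module ℝ V]

lemma wedge4_basis (e : Module.Basis (Fin 8) ℝ V) (I J : Fin 4 → Fin 8) :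
    wedge4 e I (fun i => e (J i)) = (deltaDet I J : ℝ) := by
  rw [← det_delta, wedge4]
  congr 1
  ext r c
  simp [Finsupp.single_apply, eq_comm]

lemma cayleyForm_basis (e : Module.Basis (Fin 8) ℝ V) (J : Fin 4 → Fin 8) :
    cayleyForm e (fun i => e (J i)) = (cayleyCoeff J : ℝ) := by
  simp only [cayleyForm, wedge4_basis, cayleyCoeff]
  push_cast
  ring

/-- Two alternating maps agree if they agree on increasing sequences of basis vectors. -/
lemma AlternatingMap.ext_strictMono {n k : ℕ} (e : Module.Basis (Fin n) ℝ V)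
    {f g : V [⋀^Fin k]→ₗ[ℝ] ℝ}
    (h : ∀ s : Fin k → Fin n, StrictMono s → f (fun i => e (s i)) = g (fun i => e (s i))) :
    f = g := by
  refine Module.Basis.ext_alternating e fun s hs => ?_
  have hm : StrictMono (s ∘ Tuple.sort s) :=
    (Tuple.monotone_sort s).strictMono_of_injective (hs.comp (Tuple.sort s).injective)
  have h1 := h _ hm
  have hf := f.map_perm (fun i => e (s i)) (Tuple.sort s)
  have hg := g.map_perm (fun i => e (s i)) (Tuple.sort s)
  simp only [Function.comp_def] at h1 hf hg
  rw [h1, hg] at hf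
  exact (smul_left_cancel _ hf).symm

/-- The sign of a sequence, counted by its inversions. -/
def inversionSign (p : Fin 8 → Fin 8) : ℤ :=
  ∏ j, ∏ i ∈ Finset.Ioi j, if p j < p i then 1 else -1

/-- The sign of a permutation is expressed by inversions so that it can be computed from the bare
sequence. -/
lemma det_basis_comp (e : Module.Basis (Fin 8) ℝ V) (p : Fin 8 → Fin 8) (hp : p.Injective) :
    e.det (fun i => e (p i)) = (inversionSign p : ℝ) := by
  have hb := Finite.injective_iff_bijective.1 hp
  have h := e.det.map_perm e (Equiv.ofBijective p hb)
  simp only [Function.comp_def, Equiv.ofBijective_apply, Module.Basis.det_self] at h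
  rw [h, Equiv.Perm.sign_eq_prod_prod_Ioi, inversionSign]
  simp only [Units.smul_def, Equiv.ofBijective_apply, zsmul_eq_mul, mul_one]
  push_cast
  refine Finset.prod_congr rfl fun j _ => Finset.prod_congr rfl fun i _ => ?_
  split_ifs <;> simp

/-- Only the increasing sequence that enumerates the complement of `t` contributes; for any other
one the determinant has a repeated column. -/
lemma hodgeStar5_basis (e : Module.Basis (Fin 8) ℝ V) (β : (Fin 5 → V) → ℝ)
    (s : Fin 5 → Fin 8) (hs : StrictMono s) (t : Fin 3 → Fin 8)
    (hst : (Fin.append s t).Injective) :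
    hodgeStar5 e β (fun i => e (t i)) =
      β (fun i => e (s i)) * inversionSign (Fin.append s t) := by
  have happ : ∀ s : Fin 5 → Fin 8, Fin.append (fun i => e (s i)) (fun i => e (t i)) =
      fun i => e (Fin.append s t i) := fun s => by
    ext i : 1
    refine Fin.addCases (fun i => ?_) (fun i => ?_) i <;> simp
  rw [hodgeStar5, Finset.sum_eq_single (OrderEmbedding.ofStrictMono s hs)]
  · simp only [OrderEmbedding.coe_ofStrictMono]
    rw [happ, det_basis_comp e _ hst]
  · intro s' _ hne
    rw [happ s']
    suffices h : ¬ (Fin.append s' t).Injective by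
      obtain ⟨i, j, hij, hn⟩ : ∃ i j, Fin.append s' t i = Fin.append s' t j ∧ i ≠ j := by
        simpa [Function.Injective] using h
      rw [e.det.map_eq_zero_of_eq _ (by simp only [hij]) hn, mul_zero]
    intro hinj
    apply hne
    -- An injective concatenation fills all eight indices, so the range is forced, and a strictly
    -- monotone sequence is determined by its range.
    have key : ∀ u : Fin 5 → Fin 8, (Fin.append u t).Injective →
        Set.range u = (Set.range t)ᶜ := fun u hu => by
      have hb := (Finite.injective_iff_bijective.1 hu).2
      ext x
      simp only [Set.mem_compl_iff, Set.mem_range, not_exists]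
      constructor
      · rintro ⟨i, rfl⟩ j hj
        have := @hu (Fin.castAdd 3 i) (Fin.natAdd 5 j) (by simp [hj])
        simp [Fin.ext_iff] at this
        omega
      · intro hx
        obtain ⟨i, rfl⟩ := hb x
        induction i using Fin.addCases with
        | left i => exact ⟨i, by simp⟩
        | right i => exact absurd (by simp) (hx i)
    apply DFunLike.coe_injective
    rw [OrderEmbedding.coe_ofStrictMono]
    exact (StrictMono.range_inj s'.strictMono hs).1 ((key _ hinj).trans (key _ hst).symm)
  · simp
lemma inversionSign_mul_self (p : Fin 8 → Fin 8) : inversionSign p * inversionSign p = 1 := by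
  rw [inversionSign, ← Finset.prod_mul_distrib]
  refine Finset.prod_eq_one fun j _ => ?_
  rw [← Finset.prod_mul_distrib]
  refine Finset.prod_eq_one fun i _ => ?_
  split_ifs <;> rfl

/-- The increasing enumeration of the complement of a sequence. -/
def complSeq (s : Fin 5 → Fin 8) (i : Fin 3) : Fin 8 :=
  -- For five distinct values the filtered list has three entries, so the default `0` is not
  -- reached.
  ((List.finRange 8).filter fun x => s 0 ≠ x ∧ s 1 ≠ x ∧ s 2 ≠ x ∧ s 3 ≠ x ∧ s 4 ≠ x).getD i 0

/-- The duality `⋆(e^m ∧ Ω) = i(e_m)Ω`, for the component with index `s`. -/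
def IsStarDualAt (s : Fin 5 → Fin 8) : Prop :=
  (Fin.append s (complSeq s)).Injective ∧ ∀ m,
    cayleyCoeff (Matrix.vecCons m (complSeq s)) = inversionSign (Fin.append s (complSeq s)) *
     ((if m = s 0 then cayleyCoeff ![s 1, s 2, s 3, s 4] else 0)
     - (if m = s 1 then cayleyCoeff ![s 0, s 2, s 3, s 4] else 0)
     + (if m = s 2 then cayleyCoeff ![s 0, s 1, s 3, s 4] else 0)
     - (if m = s 3 then cayleyCoeff ![s 0, s 1, s 2, s 4] else 0)
     + (if m = s 4 then cayleyCoeff ![s 0, s 1, s 2, s 3] else 0))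

instance (s : Fin 5 → Fin 8) : Decidable (IsStarDualAt s) := by
  unfold IsStarDualAt Function.Injective
  infer_instance

/-- A finite computation over the 56 increasing index sequences. Interleaving inequalities and
quantifiers prunes the enumeration. -/
lemma isStarDualAt_of_lt : ∀ a b : Fin 8, a < b → ∀ c, b < c → ∀ d, c < d → ∀ f, d < f →
    IsStarDualAt ![a, b, c, d, f] := by
  decide +kernel

/-- The inner product with `w`, for the inner product in which the basis `e` is orthonormal. -/
def innerBasis (e : Module.Basis (Fin 8) ℝ V) (w : V) : V →ₗ[ℝ] ℝ :=
  ∑ i, e.coord i w • e.coord i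

lemma innerBasis_apply (e : Module.Basis (Fin 8) ℝ V) (w v : V) :
    innerBasis e w v = ∑ i, e.coord i w * e.coord i v := by
  simp [innerBasis]

lemma innerBasis_basis (e : Module.Basis (Fin 8) ℝ V) (w : V) (i : Fin 8) :
    innerBasis e w (e i) = e.coord i w := by
  simp [innerBasis_apply, Finsupp.single_apply]

lemma innerBasis_comm (e : Module.Basis (Fin 8) ℝ V) (w v : V) :
    innerBasis e w v = innerBasis e v w := by
  simp [innerBasis_apply, mul_comm]

/-- The wedge product `φ ∧ T` of a `1`-form and a `k`-form. -/
def wedgeOne {k : ℕ} (φ : V →ₗ[ℝ] ℝ) (T : V [⋀^Fin k]→ₗ[ℝ] ℝ) : V [⋀^Fin (k + 1)]→ₗ[ℝ] ℝ :=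
  AlternatingMap.alternatizeUncurryFin (φ.smulRight T)

lemma wedgeOne_apply {k : ℕ} (φ : V →ₗ[ℝ] ℝ) (T : V [⋀^Fin k]→ₗ[ℝ] ℝ) (v : Fin (k + 1) → V) :
    wedgeOne φ T v = ∑ i : Fin (k + 1), (-1) ^ (i : ℕ) * (φ (v i) * T (i.removeNth v)) := by
  simp [wedgeOne, AlternatingMap.alternatizeUncurryFin_apply]

lemma map_vecCons_eq_sum {k : ℕ} (e : Module.Basis (Fin 8) ℝ V) (T : V [⋀^Fin (k + 1)]→ₗ[ℝ] ℝ)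
    (w : V) (v : Fin k → V) :
    T (Matrix.vecCons w v) = ∑ i, e.coord i w * T (Matrix.vecCons (e i) v) := by
  have h : ∀ x, T (Matrix.vecCons x v) =
      T.toMultilinearMap.toLinearMap (Matrix.vecCons 0 v) 0 x := fun x => by
    simp [Matrix.vecCons, Fin.update_cons_zero]
  simp only [h]
  conv_lhs => rw [← e.sum_repr w, map_sum]
  simp

/-- On an oriented Euclidean space with a `Spin(7)` form, `⋆β = i(w)Ω` means `β = w♭ ∧ Ω`. -/
theorem eq_wedgeOne_of_hodgeStar5_eq (e : Module.Basis (Fin 8) ℝ V) (Ω : V [⋀^Fin 4]→ₗ[ℝ] ℝ)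
    (hΩ : ∀ v, Ω v = cayleyForm e v) (β : V [⋀^Fin 5]→ₗ[ℝ] ℝ) (w : V)
    (h : ∀ v, hodgeStar5 e β v = Ω (Matrix.vecCons w v)) :
    β = wedgeOne (innerBasis e w) Ω := by
  have hΩ' : ∀ J : Fin 4 → Fin 8, Ω (fun i => e (J i)) = cayleyCoeff J := fun J => by
    rw [hΩ, cayleyForm_basis]
  refine AlternatingMap.ext_strictMono e fun s hs => ?_
  have hs' : s = ![s 0, s 1, s 2, s 3, s 4] := by
    ext i
    fin_cases i <;> rfl
  have hdual : IsStarDualAt s := by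
    rw [hs']
    exact isStarDualAt_of_lt _ _ (hs (by decide)) _ (hs (by decide)) _ (hs (by decide)) _
      (hs (by decide))
  have h1 := h fun i => e (complSeq s i)
  rw [hodgeStar5_basis e β s hs _ hdual.1, map_vecCons_eq_sum e] at h1
  have h2 : ∀ m, Ω (Matrix.vecCons (e m) fun i => e (complSeq s i)) =
      cayleyCoeff (Matrix.vecCons m (complSeq s)) := fun m => by
    rw [← hΩ']
    congr 1
    ext i : 1
    refine Fin.cases ?_ (fun i => ?_) i <;> simp
  -- The sign is its own inverse, which recovers β(e_s) from the component of ⋆β.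
  have h3 : ((inversionSign (Fin.append s (complSeq s)) : ℤ) : ℝ) *
      inversionSign (Fin.append s (complSeq s)) = 1 := by
    exact_mod_cast inversionSign_mul_self _
  simp only [h2, hdual.2] at h1
  rw [← mul_one (β _), ← h3, ← mul_assoc, h1, wedgeOne_apply]
  have h5 : ∀ i : Fin 5, Ω (i.removeNth fun j => e (s j)) =
      cayleyCoeff (i.removeNth s) := fun i => by
    rw [← hΩ']
    rfl
  have h6 : (0 : Fin 5).removeNth s = ![s 1, s 2, s 3, s 4] ∧
      (1 : Fin 5).removeNth s = ![s 0, s 2, s 3, s 4] ∧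
      (2 : Fin 5).removeNth s = ![s 0, s 1, s 3, s 4] ∧
      (3 : Fin 5).removeNth s = ![s 0, s 1, s 2, s 4] ∧
      (4 : Fin 5).removeNth s = ![s 0, s 1, s 2, s 3] := by
    refine ⟨?_, ?_, ?_, ?_, ?_⟩ <;> (ext j; fin_cases j <;> rfl)
  obtain ⟨h60, h61, h62, h63, h64⟩ := h6
  rw [show (∑ i : Fin (4 + 1), (-1 : ℝ) ^ (i : ℕ) * (innerBasis e w (e (s i)) *
    Ω (i.removeNth fun i => e (s i)))) = _ from Fin.sum_univ_five _]
  simp only [h5, h60, h61, h62, h63, h64, innerBasis_basis]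
  push_cast
  simp only [mul_add, mul_sub, add_mul, sub_mul, Finset.sum_add_distrib, Finset.sum_sub_distrib,
    mul_ite, mul_zero, Finset.sum_ite_eq', Finset.mem_univ, if_true]
  generalize ((inversionSign (Fin.append s (complSeq s)) : ℤ) : ℝ) = σ at h3
  simp only [show ((0 : Fin 5) : ℕ) = 0 from rfl, show ((1 : Fin 5) : ℕ) = 1 from rfl,
    show ((2 : Fin 5) : ℕ) = 2 from rfl, show ((3 : Fin 5) : ℕ) = 3 from rfl,
    show ((4 : Fin 5) : ℕ) = 4 from rfl]
  linear_combination (e.coord (s 0) w * cayleyCoeff ![s 1, s 2, s 3, s 4]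
    - e.coord (s 1) w * cayleyCoeff ![s 0, s 2, s 3, s 4]
    + e.coord (s 2) w * cayleyCoeff ![s 0, s 1, s 3, s 4]
    - e.coord (s 3) w * cayleyCoeff ![s 0, s 1, s 2, s 4]
    + e.coord (s 4) w * cayleyCoeff ![s 0, s 1, s 2, s 3]) * h3
end

/-! ### Contractions of wedge products and of the derivation action of an endomorphism. -/

noncomputable section

variable {V : Type*} [AddCommGroup V] [Module ℝ V]

section Contraction

variable {k : ℕ} (e : Module.Basis (Fin 8) ℝ V)

lemma sum_insertNth (i : Fin (k + 1)) (f : (Fin (k + 1) → Fin 8) → ℝ) :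
    ∑ J, f J = ∑ a, ∑ K : Fin k → Fin 8, f (i.insertNth a K) := by
  rw [← Fintype.sum_prod_type' (f := fun a (K : Fin k → Fin 8) => f (i.insertNth a K))]
  exact (Equiv.sum_comp (Fin.insertNthEquiv (fun _ => Fin 8) i) f).symm

lemma sum_vecCons (f : (Fin (k + 1) → Fin 8) → ℝ) :
    ∑ J, f J = ∑ a, ∑ K : Fin k → Fin 8, f (Matrix.vecCons a K) := by
  rw [sum_insertNth 0]
  simp [Matrix.vecCons]

lemma basis_comp_vecCons (a : Fin 8) (K : Fin k → Fin 8) :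
    e ∘ Matrix.vecCons a K = Matrix.vecCons (e a) (e ∘ K) := by
  ext i : 1
  refine Fin.cases ?_ (fun i => ?_) i <;> simp

lemma basis_comp_insertNth (i : Fin (k + 1)) (a : Fin 8) (K : Fin k → Fin 8) :
    e ∘ (i.insertNth a K : Fin (k + 1) → Fin 8) = i.insertNth (e a) (e ∘ K) := by
  ext j : 1
  refine Fin.succAboveCases i ?_ (fun j => ?_) j <;> simp

/-- The term in which φ receives the first vector splits off, and each other term gains a sign: the
antiderivation rule for the interior product. -/
lemma wedgeOne_vecCons (φ : V →ₗ[ℝ] ℝ) (T : V [⋀^Fin (k + 1)]→ₗ[ℝ] ℝ) (x : V)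
    (v : Fin (k + 1) → V) :
    wedgeOne φ T (Matrix.vecCons x v) = φ x * T v - wedgeOne φ (T.curryLeft x) v := by
  rw [wedgeOne_apply, wedgeOne_apply, Fin.sum_univ_succ, sub_eq_add_neg, ← Finset.sum_neg_distrib]
  congr 1
  · simp [Matrix.vecCons]
  · refine Finset.sum_congr rfl fun i _ => ?_
    have h : i.succ.removeNth (Matrix.vecCons x v) = Matrix.vecCons x (i.removeNth v) := by
      ext j : 1
      refine Fin.cases ?_ (fun j => ?_) j <;> simp [Fin.removeNth]
    simp only [h, AlternatingMap.curryLeft_apply_apply, Matrix.cons_val_succ, Fin.val_succ]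
    ring

/-- Wedging with p♭ is adjoint to contracting with `p`. Sums run over all index sequences, not only
increasing ones, so the `k + 1` positions of p♭ contribute equally. -/
lemma sum_wedgeOne_mul (p : V) (R : V [⋀^Fin k]→ₗ[ℝ] ℝ) (S : V [⋀^Fin (k + 1)]→ₗ[ℝ] ℝ) :
    ∑ J : Fin (k + 1) → Fin 8, wedgeOne (innerBasis e p) R (e ∘ J) * S (e ∘ J) =
      (k + 1) * ∑ K : Fin k → Fin 8, R (e ∘ K) * S (Matrix.vecCons p (e ∘ K)) := by
  simp only [wedgeOne_apply, Finset.sum_mul]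
  rw [Finset.sum_comm]
  have h : ∀ i : Fin (k + 1), ∑ J : Fin (k + 1) → Fin 8, (-1) ^ (i : ℕ) *
      (innerBasis e p ((e ∘ J) i) * R (i.removeNth (e ∘ J))) * S (e ∘ J) =
        ∑ K : Fin k → Fin 8, R (e ∘ K) * S (Matrix.vecCons p (e ∘ K)) := fun i => by
    rw [sum_insertNth i, Finset.sum_comm]
    refine Finset.sum_congr rfl fun K _ => ?_
    rw [map_vecCons_eq_sum e S p, Finset.mul_sum]
    refine Finset.sum_congr rfl fun a _ => ?_
    rw [basis_comp_insertNth, AlternatingMap.map_insertNth]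
    simp only [Fin.insertNth_apply_same, innerBasis_basis, Fin.removeNth_insertNth]
    -- The sign of the wedge term cancels the sign from moving the inserted vector of `S` to the
    -- front.
    have h1 : ((-1 : ℝ) ^ (i : ℕ)) * (-1) ^ (i : ℕ) = 1 := by
      rw [← mul_pow]; simp
    simp only [zsmul_eq_mul]
    push_cast
    linear_combination (e.coord a p * R (e ∘ K) * S (Matrix.vecCons (e a) (e ∘ K))) * h1
  rw [Finset.sum_congr rfl fun i _ => h i]
  simp

lemma sum_wedgeOne_vecCons_mul (p u : V) (T S : V [⋀^Fin (k + 1)]→ₗ[ℝ] ℝ) :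
    ∑ J : Fin (k + 1) → Fin 8, wedgeOne (innerBasis e p) T (Matrix.vecCons u (e ∘ J)) *
        S (e ∘ J) =
      innerBasis e p u * ∑ J : Fin (k + 1) → Fin 8, T (e ∘ J) * S (e ∘ J) -
        (k + 1) * ∑ K : Fin k → Fin 8, T (Matrix.vecCons u (e ∘ K)) *
          S (Matrix.vecCons p (e ∘ K)) := by
  simp only [wedgeOne_vecCons, sub_mul, Finset.sum_sub_distrib, sum_wedgeOne_mul, mul_assoc,
    ← Finset.mul_sum, AlternatingMap.curryLeft_apply_apply]

lemma sum_wedgeOne_vecCons_vecCons_mul (p u x : V) (T : V [⋀^Fin (k + 2)]→ₗ[ℝ] ℝ)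
    (S : V [⋀^Fin (k + 1)]→ₗ[ℝ] ℝ) :
    ∑ K : Fin (k + 1) → Fin 8,
        wedgeOne (innerBasis e p) T (Matrix.vecCons u (Matrix.vecCons x (e ∘ K))) * S (e ∘ K) =
      innerBasis e p u * ∑ K : Fin (k + 1) → Fin 8, T (Matrix.vecCons x (e ∘ K)) * S (e ∘ K) -
      innerBasis e p x * ∑ K : Fin (k + 1) → Fin 8, T (Matrix.vecCons u (e ∘ K)) * S (e ∘ K) +
        (k + 1) * ∑ L : Fin k → Fin 8, T (Matrix.vecCons u (Matrix.vecCons x (e ∘ L))) *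
          S (Matrix.vecCons p (e ∘ L)) := by
  simp only [wedgeOne_vecCons _ T, sub_mul, Finset.sum_sub_distrib, sum_wedgeOne_vecCons_mul,
    mul_assoc, ← Finset.mul_sum, AlternatingMap.curryLeft_apply_apply]
  ring

/-- The action of an endomorphism `A` on a `k`-form `T`, as a derivation. -/
def derivForm (A : V →ₗ[ℝ] V) (T : V [⋀^Fin k]→ₗ[ℝ] ℝ) : V [⋀^Fin k]→ₗ[ℝ] ℝ where
  toMultilinearMap := ∑ i, T.toMultilinearMap.compLinearMap
    (Function.update (fun _ => LinearMap.id) i A)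
  map_eq_zero_of_eq' v i j hv hij := by
    have hf : ∀ l, (fun m => (Function.update (fun _ : Fin k => (LinearMap.id : V →ₗ[ℝ] V)) l A m)
        (v m)) = Function.update v l (A (v l)) := fun l => by
      ext m : 1
      by_cases h : m = l
      · subst h; simp
      · simp [h]
    simp only [MultilinearMap.toFun_eq_coe, sum_apply,
      MultilinearMap.compLinearMap_apply, AlternatingMap.coe_multilinearMap, hf]
    -- Outside slots `i` and `j` the two equal arguments remain; the terms at `i` and `j` differ by
    -- a transposition and cancel.
    rw [← Finset.sum_subset (Finset.subset_univ {i, j})]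
    · rw [Finset.sum_pair hij]
      have h : Function.update v j (A (v j)) = Function.update v i (A (v i)) ∘ Equiv.swap i j := by
        ext m : 1
        by_cases hi : m = i
        · subst hi; simp [hij, hij.symm, hv]
        · by_cases hj : m = j
          · subst hj; simp [hv]
          · simp [Equiv.swap_apply_of_ne_of_ne hi hj, hi, hj]
      rw [h, T.map_swap _ hij]
      simp
    · intro l _ hl
      simp only [Finset.mem_insert, Finset.mem_singleton, not_or] at hl
      refine T.map_eq_zero_of_eq _ ?_ hij
      simp [Ne.symm hl.1, Ne.symm hl.2, hv]

lemma derivForm_apply (A : V →ₗ[ℝ] V) (T : V [⋀^Fin k]→ₗ[ℝ] ℝ) (v : Fin k → V) :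
    derivForm A T v = ∑ i, T (Function.update v i (A (v i))) := by
  have hf : ∀ l, (fun m => (Function.update (fun _ : Fin k => (LinearMap.id : V →ₗ[ℝ] V)) l A m)
      (v m)) = Function.update v l (A (v l)) := fun l => by
    ext m : 1
    by_cases h : m = l
    · subst h; simp
    · simp [h]
  change (∑ i, T.toMultilinearMap.compLinearMap
    (Function.update (fun _ => LinearMap.id) i A)) v = _
  simp only [sum_apply,
      MultilinearMap.compLinearMap_apply, AlternatingMap.coe_multilinearMap, hf]

lemma derivForm_vecCons (A : V →ₗ[ℝ] V) (T : V [⋀^Fin (k + 1)]→ₗ[ℝ] ℝ) (u : V) (v : Fin k → V) :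
    derivForm A T (Matrix.vecCons u v) =
      T (Matrix.vecCons (A u) v) + derivForm A (T.curryLeft u) v := by
  simp only [derivForm_apply, Fin.sum_univ_succ]
  simp [Matrix.vecCons, Fin.update_cons_zero, Fin.cons_update]

/-- By antisymmetry every slot contributes equally. When the contraction of `T` with `S` in all but
one slot is a multiple of the metric, the right side becomes a multiple of tr A. -/
lemma sum_derivForm_mul (A : V →ₗ[ℝ] V) (T S : V [⋀^Fin (k + 1)]→ₗ[ℝ] ℝ) :
    ∑ J : Fin (k + 1) → Fin 8, derivForm A T (e ∘ J) * S (e ∘ J) =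
      (k + 1) * ∑ a, ∑ K : Fin k → Fin 8, T (Matrix.vecCons (A (e a)) (e ∘ K)) *
        S (Matrix.vecCons (e a) (e ∘ K)) := by
  simp only [derivForm_apply, Finset.sum_mul]
  rw [Finset.sum_comm]
  have h : ∀ i : Fin (k + 1), ∑ J : Fin (k + 1) → Fin 8,
      T (Function.update (e ∘ J) i (A ((e ∘ J) i))) * S (e ∘ J) =
        ∑ a, ∑ K : Fin k → Fin 8, T (Matrix.vecCons (A (e a)) (e ∘ K)) *
        S (Matrix.vecCons (e a) (e ∘ K)) := fun i => by
    rw [sum_insertNth i]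
    refine Finset.sum_congr rfl fun a _ => Finset.sum_congr rfl fun K _ => ?_
    rw [basis_comp_insertNth, Fin.insertNth_apply_same, Fin.update_insertNth,
      AlternatingMap.map_insertNth, AlternatingMap.map_insertNth]
    have h1 : ((-1 : ℝ) ^ (i : ℕ)) * (-1) ^ (i : ℕ) = 1 := by
      rw [← mul_pow]; simp
    simp only [zsmul_eq_mul]
    push_cast
    linear_combination (T (Matrix.vecCons (A (e a)) (e ∘ K)) *
      S (Matrix.vecCons (e a) (e ∘ K))) * h1
  rw [Finset.sum_congr rfl fun i _ => h i]
  simp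

end Contraction
end

/-! ### The quadratic contraction identity of the Cayley form. -/

noncomputable section

variable {V : Type*} [AddCommGroup V] [Module ℝ V]

/-- Laplace expansion along the first two columns, so that `n` and `u` in the first two slots of Ω
enter only through 2 × 2 minors. -/
lemma det_fin_four (M : Matrix (Fin 4) (Fin 4) ℝ) :
    M.det =
      (M 0 0 * M 1 1 - M 0 1 * M 1 0) * (M 2 2 * M 3 3 - M 2 3 * M 3 2)
      - (M 0 0 * M 2 1 - M 0 1 * M 2 0) * (M 1 2 * M 3 3 - M 1 3 * M 3 2)
      + (M 0 0 * M 3 1 - M 0 1 * M 3 0) * (M 1 2 * M 2 3 - M 1 3 * M 2 2)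
      + (M 1 0 * M 2 1 - M 1 1 * M 2 0) * (M 0 2 * M 3 3 - M 0 3 * M 3 2)
      - (M 1 0 * M 3 1 - M 1 1 * M 3 0) * (M 0 2 * M 2 3 - M 0 3 * M 2 2)
      + (M 2 0 * M 3 1 - M 2 1 * M 3 0) * (M 0 2 * M 1 3 - M 0 3 * M 1 2) := by
  rw [Matrix.det_succ_row_zero]
  simp only [Matrix.det_fin_three, Fin.sum_univ_four, Matrix.submatrix_apply]
  simp only [show (Fin.succ 0 : Fin 4) = 1 from rfl, show (Fin.succ 1 : Fin 4) = 2 from rfl,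
    show (Fin.succ 2 : Fin 4) = 3 from rfl, Fin.succAbove_zero,
    show (1 : Fin 4).succAbove 0 = 0 from rfl, show (1 : Fin 4).succAbove 1 = 2 from rfl,
    show (1 : Fin 4).succAbove 2 = 3 from rfl, show (2 : Fin 4).succAbove 0 = 0 from rfl,
    show (2 : Fin 4).succAbove 1 = 1 from rfl, show (2 : Fin 4).succAbove 2 = 3 from rfl,
    show (3 : Fin 4).succAbove 0 = 0 from rfl, show (3 : Fin 4).succAbove 1 = 1 from rfl,
    show (3 : Fin 4).succAbove 2 = 2 from rfl, show ((0 : Fin 4) : ℕ) = 0 from rfl,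
    show ((1 : Fin 4) : ℕ) = 1 from rfl, show ((2 : Fin 4) : ℕ) = 2 from rfl,
    show ((3 : Fin 4) : ℕ) = 3 from rfl]
  ring

lemma wedge4_eq_sum (e : Module.Basis (Fin 8) ℝ V) (i j k l : Fin 8) (x y z u : V) :
    wedge4 e ![i, j, k, l] ![x, y, z, u] =
      (e.coord i x * e.coord j y - e.coord i y * e.coord j x) *
        (e.coord k z * e.coord l u - e.coord k u * e.coord l z)
      - (e.coord i x * e.coord k y - e.coord i y * e.coord k x) *
        (e.coord j z * e.coord l u - e.coord j u * e.coord l z)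
      + (e.coord i x * e.coord l y - e.coord i y * e.coord l x) *
        (e.coord j z * e.coord k u - e.coord j u * e.coord k z)
      + (e.coord j x * e.coord k y - e.coord j y * e.coord k x) *
        (e.coord i z * e.coord l u - e.coord i u * e.coord l z)
      - (e.coord j x * e.coord l y - e.coord j y * e.coord l x) *
        (e.coord i z * e.coord k u - e.coord i u * e.coord k z)
      + (e.coord k x * e.coord l y - e.coord k y * e.coord l x) *
        (e.coord i z * e.coord j u - e.coord i u * e.coord j z) := by
  rw [wedge4, det_fin_four]
  rfl

-- Each component of Ω(n, u, ·, ·) is a signed sum of three Plücker coordinates `m i j` of n ∧ u. In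
-- the sum of squares over a < b every coordinate with i < j is squared three times, and the cross
-- terms group into Plücker relations, which vanish. This gives 3|n ∧ u|², doubled by summing over
-- ordered pairs.
set_option maxHeartbeats 4000000 in
lemma sum_sq_contraction_two (e : Module.Basis (Fin 8) ℝ V) (Ω : V [⋀^Fin 4]→ₗ[ℝ] ℝ)
    (hΩ : ∀ v, Ω v = cayleyForm e v) (n u : V) :
    ∑ a, ∑ b, Ω ![n, u, e a, e b] * Ω ![n, u, e a, e b] =
      6 * (innerBasis e n n * innerBasis e u u - innerBasis e n u * innerBasis e n u) := by
  have hself : ∀ a, Ω ![n, u, e a, e a] = 0 := fun a =>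
    Ω.map_eq_zero_of_eq _ (i := 2) (j := 3) rfl (by decide)
  have hswap : ∀ a b, Ω ![n, u, e a, e b] = -Ω ![n, u, e b, e a] := fun a b => by
    rw [← Ω.map_swap _ (show (2 : Fin 4) ≠ 3 by decide)]
    congr 1
    ext i : 1
    fin_cases i <;> rfl
  let m : Fin 8 → Fin 8 → ℝ := fun i j => e.coord i n * e.coord j u - e.coord i u * e.coord j n
  have h01 : Ω ![n, u, e 0, e 1] = m 2 3 - m 4 5 - m 6 7 := by
    rw [hΩ]; simp [cayleyForm, wedge4_eq_sum, m]; try ring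
  have h02 : Ω ![n, u, e 0, e 2] = - m 1 3 - m 4 6 + m 5 7 := by
    rw [hΩ]; simp [cayleyForm, wedge4_eq_sum, m]; try ring
  have h03 : Ω ![n, u, e 0, e 3] = m 1 2 - m 4 7 - m 5 6 := by
    rw [hΩ]; simp [cayleyForm, wedge4_eq_sum, m]; try ring
  have h04 : Ω ![n, u, e 0, e 4] = m 1 5 + m 2 6 + m 3 7 := by
    rw [hΩ]; simp [cayleyForm, wedge4_eq_sum, m]; try ring
  have h05 : Ω ![n, u, e 0, e 5] = - m 1 4 - m 2 7 + m 3 6 := by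
    rw [hΩ]; simp [cayleyForm, wedge4_eq_sum, m]; try ring
  have h06 : Ω ![n, u, e 0, e 6] = m 1 7 - m 2 4 - m 3 5 := by
    rw [hΩ]; simp [cayleyForm, wedge4_eq_sum, m]; try ring
  have h07 : Ω ![n, u, e 0, e 7] = - m 1 6 + m 2 5 - m 3 4 := by
    rw [hΩ]; simp [cayleyForm, wedge4_eq_sum, m]; try ring
  have h12 : Ω ![n, u, e 1, e 2] = m 0 3 - m 5 6 - m 4 7 := by
    rw [hΩ]; simp [cayleyForm, wedge4_eq_sum, m]; try ring
  have h13 : Ω ![n, u, e 1, e 3] = - m 0 2 - m 5 7 + m 4 6 := by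
    rw [hΩ]; simp [cayleyForm, wedge4_eq_sum, m]; try ring
  have h14 : Ω ![n, u, e 1, e 4] = - m 0 5 - m 3 6 + m 2 7 := by
    rw [hΩ]; simp [cayleyForm, wedge4_eq_sum, m]; try ring
  have h15 : Ω ![n, u, e 1, e 5] = m 0 4 + m 3 7 + m 2 6 := by
    rw [hΩ]; simp [cayleyForm, wedge4_eq_sum, m]; try ring
  have h16 : Ω ![n, u, e 1, e 6] = - m 0 7 + m 3 4 - m 2 5 := by
    rw [hΩ]; simp [cayleyForm, wedge4_eq_sum, m]; try ring
  have h17 : Ω ![n, u, e 1, e 7] = m 0 6 - m 3 5 - m 2 4 := by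
    rw [hΩ]; simp [cayleyForm, wedge4_eq_sum, m]; try ring
  have h23 : Ω ![n, u, e 2, e 3] = m 0 1 - m 6 7 - m 4 5 := by
    rw [hΩ]; simp [cayleyForm, wedge4_eq_sum, m]; try ring
  have h24 : Ω ![n, u, e 2, e 4] = - m 0 6 + m 3 5 - m 1 7 := by
    rw [hΩ]; simp [cayleyForm, wedge4_eq_sum, m]; try ring
  have h25 : Ω ![n, u, e 2, e 5] = m 0 7 - m 3 4 - m 1 6 := by
    rw [hΩ]; simp [cayleyForm, wedge4_eq_sum, m]; try ring
  have h26 : Ω ![n, u, e 2, e 6] = m 0 4 + m 3 7 + m 1 5 := by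
    rw [hΩ]; simp [cayleyForm, wedge4_eq_sum, m]; try ring
  have h27 : Ω ![n, u, e 2, e 7] = - m 0 5 - m 3 6 + m 1 4 := by
    rw [hΩ]; simp [cayleyForm, wedge4_eq_sum, m]; try ring
  have h34 : Ω ![n, u, e 3, e 4] = - m 0 7 - m 2 5 + m 1 6 := by
    rw [hΩ]; simp [cayleyForm, wedge4_eq_sum, m]; try ring
  have h35 : Ω ![n, u, e 3, e 5] = - m 0 6 + m 2 4 - m 1 7 := by
    rw [hΩ]; simp [cayleyForm, wedge4_eq_sum, m]; try ring
  have h36 : Ω ![n, u, e 3, e 6] = m 0 5 - m 2 7 - m 1 4 := by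
    rw [hΩ]; simp [cayleyForm, wedge4_eq_sum, m]; try ring
  have h37 : Ω ![n, u, e 3, e 7] = m 0 4 + m 2 6 + m 1 5 := by
    rw [hΩ]; simp [cayleyForm, wedge4_eq_sum, m]; try ring
  have h45 : Ω ![n, u, e 4, e 5] = - m 0 1 + m 6 7 - m 2 3 := by
    rw [hΩ]; simp [cayleyForm, wedge4_eq_sum, m]; try ring
  have h46 : Ω ![n, u, e 4, e 6] = - m 0 2 - m 5 7 + m 1 3 := by
    rw [hΩ]; simp [cayleyForm, wedge4_eq_sum, m]; try ring
  have h47 : Ω ![n, u, e 4, e 7] = - m 0 3 + m 5 6 - m 1 2 := by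
    rw [hΩ]; simp [cayleyForm, wedge4_eq_sum, m]; try ring
  have h56 : Ω ![n, u, e 5, e 6] = - m 0 3 + m 4 7 - m 1 2 := by
    rw [hΩ]; simp [cayleyForm, wedge4_eq_sum, m]; try ring
  have h57 : Ω ![n, u, e 5, e 7] = m 0 2 - m 4 6 - m 1 3 := by
    rw [hΩ]; simp [cayleyForm, wedge4_eq_sum, m]; try ring
  have h67 : Ω ![n, u, e 6, e 7] = - m 0 1 + m 4 5 - m 2 3 := by
    rw [hΩ]; simp [cayleyForm, wedge4_eq_sum, m]; try ring
  simp only [Fin.sum_univ_eight, hself, innerBasis_apply]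
  rw [hswap 1 0, hswap 2 0, hswap 3 0, hswap 4 0, hswap 5 0, hswap 6 0, hswap 7 0, hswap 2 1,
    hswap 3 1, hswap 4 1, hswap 5 1, hswap 6 1, hswap 7 1, hswap 3 2, hswap 4 2, hswap 5 2, hswap
    6 2, hswap 7 2, hswap 4 3, hswap 5 3, hswap 6 3, hswap 7 3, hswap 5 4, hswap 6 4, hswap 7 4,
    hswap 6 5, hswap 7 5, hswap 7 6]
  simp only [h01, h02, h03, h04, h05, h06, h07, h12, h13, h14, h15, h16, h17, h23, h24, h25, h26,
    h27, h34, h35, h36, h37, h45, h46, h47, h56, h57, h67, m]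
  ring
end

/-! ### Vanishing of w, and quasi-abelian Lie algebras. -/

noncomputable section

variable {V : Type*} [AddCommGroup V] [Module ℝ V]

section Cayley

variable (e : Module.Basis (Fin 8) ℝ V) (Ω : V [⋀^Fin 4]→ₗ[ℝ] ℝ)
    (hΩ : ∀ v, Ω v = cayleyForm e v)

lemma innerBasis_self_nonneg (u : V) : 0 ≤ innerBasis e u u := by
  rw [innerBasis_apply]
  exact Finset.sum_nonneg fun i _ => mul_self_nonneg _

lemma eq_zero_of_innerBasis_self (u : V) (h : innerBasis e u u = 0) : u = 0 := by
  rw [innerBasis_apply, Finset.sum_eq_zero_iff_of_nonneg fun i _ => mul_self_nonneg _] at h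
  refine e.ext_elem fun i => ?_
  simpa using h i (Finset.mem_univ i)

lemma sum_innerBasis_mul (u v : V) :
    ∑ a, innerBasis e u (e a) * innerBasis e v (e a) = innerBasis e u v := by
  simp only [innerBasis_basis]
  rw [innerBasis_apply]

lemma innerBasis_basis_basis (a : Fin 8) : innerBasis e (e a) (e a) = 1 := by
  simp [innerBasis_basis]

lemma sum_pair_eq (f : V → V → ℝ) :
    ∑ L : Fin 2 → Fin 8, f (e (L 0)) (e (L 1)) = ∑ a, ∑ b, f (e a) (e b) := by
  rw [← Fintype.sum_prod_type' (f := fun a b => f (e a) (e b))]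
  exact Equiv.sum_comp (finTwoArrowEquiv (Fin 8)) fun p : Fin 8 × Fin 8 => f (e p.1) (e p.2)

-- Polarisation in `u` of the quadratic identity.
include hΩ in
lemma sum_contraction_two (n u v : V) :
    ∑ L : Fin 2 → Fin 8, Ω (Matrix.vecCons n (Matrix.vecCons u (e ∘ L))) *
        Ω (Matrix.vecCons n (Matrix.vecCons v (e ∘ L))) =
      6 * (innerBasis e n n * innerBasis e u v - innerBasis e n u * innerBasis e n v) := by
  have hq : ∀ u, ∑ L : Fin 2 → Fin 8, Ω (Matrix.vecCons n (Matrix.vecCons u (e ∘ L))) *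
        Ω (Matrix.vecCons n (Matrix.vecCons u (e ∘ L))) =
      6 * (innerBasis e n n * innerBasis e u u - innerBasis e n u * innerBasis e n u) := fun u => by
    rw [← sum_sq_contraction_two e Ω hΩ,
      ← sum_pair_eq e fun x y => Ω ![n, u, x, y] * Ω ![n, u, x, y]]
    refine Finset.sum_congr rfl fun L _ => ?_
    have h : e ∘ L = ![e (L 0), e (L 1)] := by
      ext i : 1
      fin_cases i <;> rfl
    rw [h]
  have hadd : ∀ L : Fin 2 → Fin 8, Ω (Matrix.vecCons n (Matrix.vecCons (u + v) (e ∘ L))) =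
      Ω (Matrix.vecCons n (Matrix.vecCons u (e ∘ L))) +
        Ω (Matrix.vecCons n (Matrix.vecCons v (e ∘ L))) := fun L => by
    simp only [← AlternatingMap.curryLeft_apply_apply, map_add, AlternatingMap.add_apply]
  have h1 := hq u
  have h2 := hq v
  have h3 := hq (u + v)
  simp only [hadd, mul_add, add_mul, Finset.sum_add_distrib, map_add] at h3
  have h4 : ∑ L : Fin 2 → Fin 8, Ω (Matrix.vecCons n (Matrix.vecCons v (e ∘ L))) *
        Ω (Matrix.vecCons n (Matrix.vecCons u (e ∘ L))) =
      ∑ L : Fin 2 → Fin 8, Ω (Matrix.vecCons n (Matrix.vecCons u (e ∘ L))) *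
        Ω (Matrix.vecCons n (Matrix.vecCons v (e ∘ L))) :=
    Finset.sum_congr rfl fun L _ => mul_comm _ _
  rw [h4, h1, h2, innerBasis_comm e (u + v) u, innerBasis_comm e (u + v) v, map_add, map_add,
    innerBasis_comm e v u] at h3
  linarith

lemma map_vecCons_swap {k : ℕ} (T : V [⋀^Fin (k + 2)]→ₗ[ℝ] ℝ) (x y : V) (v : Fin k → V) :
    T (Matrix.vecCons x (Matrix.vecCons y v)) = -T (Matrix.vecCons y (Matrix.vecCons x v)) := by
  rw [← T.map_swap _ (show (0 : Fin (k + 2)) ≠ 1 by simp)]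
  congr 1
  ext i : 1
  refine Fin.cases (by simp) (fun i => Fin.cases (by simp) (fun i => ?_) i) i
  rw [Function.comp_apply, Equiv.swap_apply_of_ne_of_ne]
  · simp
  · exact Fin.succ_ne_zero _
  · rw [Ne, ← Fin.succ_zero_eq_one, Fin.succ_inj]
    exact Fin.succ_ne_zero _

-- Summing the previous contraction over an orthonormal basis gives 6 · (8 − 1) = 42.
include hΩ in
lemma sum_contraction_three (u v : V) :
    ∑ K : Fin 3 → Fin 8, Ω (Matrix.vecCons u (e ∘ K)) * Ω (Matrix.vecCons v (e ∘ K)) =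
      42 * innerBasis e u v := by
  rw [sum_vecCons]
  simp only [basis_comp_vecCons, map_vecCons_swap Ω u, map_vecCons_swap Ω v, neg_mul_neg]
  rw [Finset.sum_congr rfl fun a _ => sum_contraction_two e Ω hΩ (e a) u v, ← Finset.mul_sum]
  simp only [innerBasis_basis_basis, innerBasis_comm e (e _), one_mul, Finset.sum_sub_distrib,
    sum_innerBasis_mul]
  simp
  ring

include hΩ in
lemma sum_contraction_four : ∑ J : Fin 4 → Fin 8, Ω (e ∘ J) * Ω (e ∘ J) = 336 := by
  rw [sum_vecCons]
  simp only [basis_comp_vecCons]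
  rw [Finset.sum_congr rfl fun a _ => sum_contraction_three e Ω hΩ (e a) (e a)]
  simp only [innerBasis_basis_basis]
  norm_num

lemma trace_eq_sum_innerBasis (A : V →ₗ[ℝ] V) :
    LinearMap.trace ℝ V A = ∑ a, innerBasis e (A (e a)) (e a) := by
  rw [LinearMap.trace_eq_matrix_trace ℝ e, Matrix.trace]
  simp [innerBasis_basis, LinearMap.toMatrix_apply]

include hΩ in
/-- If `η ∧ A·Ω` is of the form `w ∧ Ω`, where `η` is the projection onto the unit vector `n`
and `A` is a trace-free endomorphism that kills `n` and has image in `n^⊥`, then `w = 0`. -/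
theorem eq_zero_of_wedgeOne_derivForm_eq (n w : V) (A : V →ₗ[ℝ] V) (hn : innerBasis e n n = 1)
    (hA : A n = 0) (hA' : ∀ v, innerBasis e n (A v) = 0) (htr : LinearMap.trace ℝ V A = 0)
    (h : wedgeOne (innerBasis e n) (-derivForm A Ω) = wedgeOne (innerBasis e w) Ω) : w = 0 := by
  -- The constant is 336 − 4 · 42.
  have hC : ∀ u, ∑ J : Fin 4 → Fin 8, wedgeOne (innerBasis e w) Ω (Matrix.vecCons u (e ∘ J)) *
      Ω (e ∘ J) = 168 * innerBasis e w u := fun u => by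
    rw [sum_wedgeOne_vecCons_mul, sum_contraction_four e Ω hΩ, sum_contraction_three e Ω hΩ,
      innerBasis_comm e u w]
    push_cast
    ring
  -- The pairing equals 4 · 42 · tr A.
  have hAΩ : ∑ J : Fin 4 → Fin 8, derivForm A Ω (e ∘ J) * Ω (e ∘ J) = 0 := by
    rw [sum_derivForm_mul]
    simp only [sum_contraction_three e Ω hΩ, ← Finset.mul_sum, ← trace_eq_sum_innerBasis, htr]
    simp
  -- Since A n = 0, contraction with `n` commutes with the action of A. As A takes values in n^⊥,
  -- the pairing is 3 · 6 · tr A.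
  have hAn : ∑ K : Fin 3 → Fin 8, derivForm A Ω (Matrix.vecCons n (e ∘ K)) *
      Ω (Matrix.vecCons n (e ∘ K)) = 0 := by
    simp only [derivForm_vecCons, hA, add_mul, Finset.sum_add_distrib]
    have h0 : ∀ v : Fin 3 → V, Ω (Matrix.vecCons 0 v) = 0 := fun v => Ω.map_coord_zero 0 rfl
    have h1 := sum_derivForm_mul e A (Ω.curryLeft n) (Ω.curryLeft n)
    simp only [AlternatingMap.curryLeft_apply_apply, sum_contraction_two e Ω hΩ, hA', hn,
      zero_mul, sub_zero, one_mul, ← Finset.mul_sum, ← trace_eq_sum_innerBasis, htr] at h1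
    simp only [h0, zero_mul, Finset.sum_const_zero, zero_add]
    rw [h1]
    simp
  have hwn : innerBasis e w n = 0 := by
    have h1 := hC n
    rw [← h, sum_wedgeOne_vecCons_mul] at h1
    simp only [AlternatingMap.neg_apply, neg_mul, Finset.sum_neg_distrib, hAΩ, hAn] at h1
    linarith
  have hnw : innerBasis e n w = 0 := by rw [innerBasis_comm, hwn]
  -- With T = −A·Ω and Q = ∑ T(w, ·)Ω(n, ·), this contraction gives −4Q = 168|w|². Evaluating the
  -- equation on (n, w, ·) against i(n)Ω gives Q = (−42 + 3 · 6)|w|². The two agree only if w = 0.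
  have h1 := hC w
  rw [← h, sum_wedgeOne_vecCons_mul, hnw] at h1
  have h2 := sum_wedgeOne_vecCons_vecCons_mul e n n w (-derivForm A Ω) (Ω.curryLeft n)
  have h3 := sum_wedgeOne_vecCons_vecCons_mul e w n w Ω (Ω.curryLeft n)
  rw [h, h3] at h2
  have h4 : ∀ v : Fin 2 → V, Ω (Matrix.vecCons n (Matrix.vecCons n v)) = 0 := fun v =>
    Ω.map_eq_zero_of_eq _ (i := 0) (j := 1) rfl (by decide)
  simp only [AlternatingMap.curryLeft_apply_apply, hn, hnw, hwn, h4, mul_zero, zero_mul,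
    Finset.sum_const_zero, sum_contraction_three e Ω hΩ, sum_contraction_two e Ω hΩ] at h2
  refine eq_zero_of_innerBasis_self e w ?_
  push_cast at h1 h2
  linarith

end Cayley

section Lie

variable {L : Type*} [LieRing L] [LieAlgebra ℝ L]

/-- The Chevalley–Eilenberg differential of a `4`-form on a Lie algebra. -/
def lieDiff (Ω : L [⋀^Fin 4]→ₗ[ℝ] ℝ) (v : Fin 5 → L) : ℝ :=
  -- The bracketed slots are `i` and `j + 1`; the leading minus restores the usual sign of that
  -- pair.
  -∑ i : Fin 4, ∑ j ≥ i, (-1) ^ (i + j : ℕ) •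
    Ω (Matrix.vecCons ⁅v i.castSucc, v j.succ⁆ (j.removeNth <| i.castSucc.removeNth v))

/-- On `1`-forms dα(u, v) = −α[u, v] is already η ∧ (−A·α). For `4`-forms both sides expand into
terms indexed by ordered pairs of slots, one fed to η and the other moved by A. -/
lemma lieDiff_eq_wedgeOne (Ω : L [⋀^Fin 4]→ₗ[ℝ] ℝ) (η : L →ₗ[ℝ] ℝ) (A : L →ₗ[ℝ] L)
    (h : ∀ u v, ⁅u, v⁆ = η u • A v - η v • A u) (v : Fin 5 → L) :
    lieDiff Ω v = wedgeOne η (-derivForm A Ω) v := by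
  have hv : v = ![v 0, v 1, v 2, v 3, v 4] := by
    ext i : 1
    fin_cases i <;> rfl
  generalize v 0 = a at hv
  generalize v 1 = b at hv
  generalize v 2 = c at hv
  generalize v 3 = d at hv
  generalize v 4 = f at hv
  subst hv
  have hsub : ∀ (p q : ℝ) (x y : L) (v : Fin 3 → L), Ω (Matrix.vecCons (p • x - q • y) v) =
      p * Ω (Matrix.vecCons x v) - q * Ω (Matrix.vecCons y v) := fun p q x y v => by
    simp only [← AlternatingMap.curryLeft_apply_apply, map_sub, map_smul,
      AlternatingMap.sub_apply, AlternatingMap.smul_apply, smul_eq_mul]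
  have hder : ∀ x y z u, derivForm A Ω ![x, y, z, u] = Ω ![A x, y, z, u] - Ω ![A y, x, z, u]
      + Ω ![A z, x, y, u] - Ω ![A u, x, y, z] := fun x y z u => by
    have h1 := Ω.map_insertNth 1 (A y) ![x, z, u]
    have h2 := Ω.map_insertNth 2 (A z) ![x, y, u]
    have h3 := Ω.map_insertNth 3 (A u) ![x, y, z]
    have e1 : (1 : Fin 4).insertNth (α := fun _ => L) (A y) ![x, z, u] = ![x, A y, z, u] := by
      ext i : 1
      fin_cases i <;> rfl
    have e2 : (2 : Fin 4).insertNth (α := fun _ => L) (A z) ![x, y, u] = ![x, y, A z, u] := by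
      ext i : 1
      fin_cases i <;> rfl
    have e3 : (3 : Fin 4).insertNth (α := fun _ => L) (A u) ![x, y, z] = ![x, y, z, A u] := by
      ext i : 1
      fin_cases i <;> rfl
    have u0 : Function.update ![x, y, z, u] 0 (A x) = ![A x, y, z, u] := by
      ext i : 1
      fin_cases i <;> rfl
    have u1 : Function.update ![x, y, z, u] 1 (A y) = ![x, A y, z, u] := by
      ext i : 1
      fin_cases i <;> rfl
    have u2 : Function.update ![x, y, z, u] 2 (A z) = ![x, y, A z, u] := by
      ext i : 1
      fin_cases i <;> rfl
    have u3 : Function.update ![x, y, z, u] 3 (A u) = ![x, y, z, A u] := by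
      ext i : 1
      fin_cases i <;> rfl
    rw [e1] at h1
    rw [e2] at h2
    rw [e3] at h3
    rw [derivForm_apply, Fin.sum_univ_four]
    simp only [Matrix.cons_val]
    rw [u0, u1, u2, u3, h1, h2, h3]
    simp
    ring
  have hw := wedgeOne_apply η (-derivForm A Ω) ![a, b, c, d, f]
  rw [hw, show (∑ i : Fin (4 + 1), (-1 : ℝ) ^ (i : ℕ) * (η (![a, b, c, d, f] i) *
    (-derivForm A Ω) (i.removeNth ![a, b, c, d, f]))) = _ from Fin.sum_univ_five _]
  have r0 : (0 : Fin 5).removeNth ![a, b, c, d, f] = ![b, c, d, f] := by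
    ext j : 1
    fin_cases j <;> rfl
  have r1 : (1 : Fin 5).removeNth ![a, b, c, d, f] = ![a, c, d, f] := by
    ext j : 1
    fin_cases j <;> rfl
  have r2 : (2 : Fin 5).removeNth ![a, b, c, d, f] = ![a, b, d, f] := by
    ext j : 1
    fin_cases j <;> rfl
  have r3 : (3 : Fin 5).removeNth ![a, b, c, d, f] = ![a, b, c, f] := by
    ext j : 1
    fin_cases j <;> rfl
  have r4 : (4 : Fin 5).removeNth ![a, b, c, d, f] = ![a, b, c, d] := by
    ext j : 1
    fin_cases j <;> rfl
  have q0 : ∀ x y z u : L, (0 : Fin 4).removeNth ![x, y, z, u] = ![y, z, u] := fun x y z u => by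
    ext j : 1
    fin_cases j <;> rfl
  have q1 : ∀ x y z u : L, (1 : Fin 4).removeNth ![x, y, z, u] = ![x, z, u] := fun x y z u => by
    ext j : 1
    fin_cases j <;> rfl
  have q2 : ∀ x y z u : L, (2 : Fin 4).removeNth ![x, y, z, u] = ![x, y, u] := fun x y z u => by
    ext j : 1
    fin_cases j <;> rfl
  have q3 : ∀ x y z u : L, (3 : Fin 4).removeNth ![x, y, z, u] = ![x, y, z] := fun x y z u => by
    ext j : 1
    fin_cases j <;> rfl
  have i0 : ∀ g : Fin 4 → ℝ, ∑ j ≥ 0, g j = g 0 + g 1 + g 2 + g 3 := fun g => by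
    rw [show Finset.Ici (0 : Fin 4) = Finset.univ by decide, Fin.sum_univ_four]
  have i1 : ∀ g : Fin 4 → ℝ, ∑ j ≥ 1, g j = g 1 + g 2 + g 3 := fun g => by
    rw [show Finset.Ici (1 : Fin 4) = {1, 2, 3} by decide, Finset.sum_insert (by decide),
      Finset.sum_pair (by decide), add_assoc]
  have i2 : ∀ g : Fin 4 → ℝ, ∑ j ≥ 2, g j = g 2 + g 3 := fun g => by
    rw [show Finset.Ici (2 : Fin 4) = {2, 3} by decide, Finset.sum_pair (by decide)]
  have i3 : ∀ g : Fin 4 → ℝ, ∑ j ≥ 3, g j = g 3 := fun g => by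
    rw [show Finset.Ici (3 : Fin 4) = {3} by decide, Finset.sum_singleton]
  rw [lieDiff, Fin.sum_univ_four, i0, i1, i2, i3]
  simp only [Fin.castSucc_zero, show Fin.castSucc (1 : Fin 4) = 1 from rfl,
    show Fin.castSucc (2 : Fin 4) = 2 from rfl, show Fin.castSucc (3 : Fin 4) = 3 from rfl,
    show Fin.succ (0 : Fin 4) = 1 from rfl, show Fin.succ (1 : Fin 4) = 2 from rfl,
    show Fin.succ (2 : Fin 4) = 3 from rfl, show Fin.succ (3 : Fin 4) = 4 from rfl]
  simp only [r0, r1, r2, r3, r4, q0, q1, q2, q3, h, hsub, AlternatingMap.neg_apply, hder]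
  simp
  ring

/-- The covector with kernel a given hyperplane. -/
lemma exists_ker_eq_of_finrank_quotient {V : Type*} [AddCommGroup V] [Module ℝ V]
    (p : Submodule ℝ V) (hp : Module.finrank ℝ (V ⧸ p) = 1) :
    ∃ η : V →ₗ[ℝ] ℝ, η ≠ 0 ∧ LinearMap.ker η = p := by
  have : Module.Finite ℝ (V ⧸ p) := Module.finite_of_finrank_pos (by omega)
  let f : (V ⧸ p) ≃ₗ[ℝ] ℝ := LinearEquiv.ofFinrankEq _ _ (by simp [hp])
  have hker : LinearMap.ker (f.toLinearMap ∘ₗ p.mkQ) = p := by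
    rw [LinearMap.ker_comp, LinearEquiv.ker, Submodule.comap_bot, Submodule.ker_mkQ]
  refine ⟨f.toLinearMap ∘ₗ p.mkQ, fun h0 => ?_, hker⟩
  rw [h0, LinearMap.ker_zero] at hker
  subst hker
  rw [Module.finrank_eq_zero_of_subsingleton] at hp
  omega

/-- The structure of a quasi-abelian Lie algebra with a Euclidean structure. -/
lemma IsQuasiAbelian.exists_bracket_eq (hL : IsQuasiAbelian L) (e : Module.Basis (Fin 8) ℝ L) :
    ∃ n : L, innerBasis e n n = 1 ∧ (∀ v, innerBasis e n ⁅n, v⁆ = 0) ∧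
      ∀ u v, ⁅u, v⁆ = innerBasis e n u • ⁅n, v⁆ - innerBasis e n v • ⁅n, u⁆ := by
  obtain ⟨H, hab, hcodim⟩ := hL
  obtain ⟨η, hη0, hη⟩ := exists_ker_eq_of_finrank_quotient _ hcodim
  -- The vector dual to η for the inner product in which `e` is orthonormal; it is then normalised
  -- by `c`.
  let m : L := ∑ i, η (e i) • e i
  have hm : innerBasis e m = η := by
    refine e.ext fun i => ?_
    simp [innerBasis_basis, m, Finsupp.single_apply]
  have hmm : 0 < innerBasis e m m := by
    refine lt_of_le_of_ne (innerBasis_self_nonneg e m) fun h0 => hη0 ?_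
    rw [← hm, eq_zero_of_innerBasis_self e m h0.symm]
    ext v
    simp [innerBasis_apply]
  set c := (Real.sqrt (innerBasis e m m))⁻¹ with hc
  have hc0 : c ≠ 0 := inv_ne_zero (Real.sqrt_pos.2 hmm).ne'
  have hcn : ∀ v, innerBasis e (c • m) v = c * η v := fun v => by
    rw [innerBasis_comm, map_smul, innerBasis_comm, hm, smul_eq_mul]
  have hmem : ∀ v, v ∈ H ↔ innerBasis e (c • m) v = 0 := fun v => by
    rw [hcn, mul_eq_zero, or_iff_right hc0, ← LinearMap.mem_ker, hη]
    rfl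
  have h1 : innerBasis e (c • m) (c • m) = 1 := by
    rw [hcn, map_smul, ← hm, smul_eq_mul, ← mul_assoc, hc, ← mul_inv,
      Real.mul_self_sqrt hmm.le, inv_mul_cancel₀ hmm.ne']
  generalize c • m = n at hmem h1
  have hproj : ∀ v, v - innerBasis e n v • n ∈ H := fun v => by
    rw [hmem, map_sub, map_smul, h1, smul_eq_mul, mul_one, sub_self]
  have hcomm : ∀ u v : L, u ∈ H → v ∈ H → ⁅u, v⁆ = 0 := fun u v hu hv => by
    have h := hab.trivial ⟨u, hu⟩ ⟨v, hv⟩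
    simpa using congrArg Subtype.val h
  refine ⟨n, h1, fun v => ?_, fun u v => ?_⟩
  -- Removing from `v` its component along `n` does not change [n, v], which therefore lies in the
  -- ideal.
  · have h := lie_mem_right ℝ L H n _ (hproj v)
    rw [lie_sub, lie_smul, lie_self, smul_zero, sub_zero] at h
    exact (hmem _).1 h
  -- The projections of `u` and `v` to the abelian ideal commute; expanding that bracket gives the
  -- formula.
  · have h := hcomm _ _ (hproj u) (hproj v)
    simp only [sub_lie, lie_sub, smul_lie, lie_smul, lie_self, smul_zero] at h
    rw [sub_zero, ← lie_skew u n, smul_neg, sub_neg_eq_add] at h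
    rw [← sub_eq_zero, ← h]
    abel

/-- On a unimodular quasi-abelian Lie algebra, a locally conformally parallel `Spin(7)` structure
is parallel. -/
theorem hodgeStar5_lieDiff_eq_zero (hL : IsQuasiAbelian L)
    (htr : ∀ x : L, LinearMap.trace ℝ L (LieAlgebra.ad ℝ L x) = 0)
    (e : Module.Basis (Fin 8) ℝ L) (Ω : L [⋀^Fin 4]→ₗ[ℝ] ℝ)
    (hΩ : ∀ v, Ω v = cayleyForm e v) (w : L)
    (h : ∀ v, hodgeStar5 e (lieDiff Ω) v = Ω (Matrix.vecCons w v)) (v : Fin 3 → L) :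
    hodgeStar5 e (lieDiff Ω) v = 0 := by
  obtain ⟨n, hn, hn', hbr⟩ := hL.exists_bracket_eq e
  have hβ : lieDiff Ω =
      wedgeOne (innerBasis e n) (-derivForm (LieAlgebra.ad ℝ L n) Ω) := by
    funext v
    exact lieDiff_eq_wedgeOne Ω _ _ hbr v
  have hw : w = 0 := by
    rw [hβ] at h
    exact eq_zero_of_wedgeOne_derivForm_eq e Ω hΩ n w _ hn (lie_self n) hn' (htr n)
      (eq_wedgeOne_of_hodgeStar5_eq e Ω hΩ _ w h)
  rw [h, hw]
  exact Ω.map_coord_zero 0 rfl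

end Lie
end

/-! ### Left-invariant fields and the exterior derivative of invariant forms. -/

noncomputable section

section Derivative

variable {M N P : Type*} [TopologicalSpace M] [ChartedSpace R8 M]
  [TopologicalSpace N] [ChartedSpace R8 N] [TopologicalSpace P] [ChartedSpace R8 P]

/-- The derivative of a map between `8`-manifolds, as an endomorphism of the model space. -/
def mderiv (f : M → N) (x : M) : R8 →L[ℝ] R8 := mfderiv 𝓘(ℝ, R8) 𝓘(ℝ, R8) f x

lemma mderiv_comp {g : N → P} {f : M → N} {x : M} (hg : MDifferentiableAt 𝓘(ℝ, R8) 𝓘(ℝ, R8) g (f x))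
    (hf : MDifferentiableAt 𝓘(ℝ, R8) 𝓘(ℝ, R8) f x) :
    mderiv (g ∘ f) x = (mderiv g (f x)).comp (mderiv f x) :=
  mfderiv_comp x hg hf

lemma mderiv_congr {f g : M → N} {x : M} (h : f =ᶠ[𝓝 x] g) : mderiv f x = mderiv g x :=
  h.mfderiv_eq

lemma mderiv_id (x : M) : mderiv (id : M → M) x = ContinuousLinearMap.id ℝ R8 :=
  mfderiv_id

lemma mderiv_eq_fderiv (f : R8 → R8) (x : R8) : mderiv f x = fderiv ℝ f x :=
  mfderiv_eq_fderiv

/-- The components of a differential form at a point. -/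
def DiffForm.toModel {k : ℕ} (α : DiffForm M k) (x : M) : R8 [⋀^Fin k]→L[ℝ] ℝ := α x

lemma DiffForm.pullback_toModel {k : ℕ} (α : DiffForm M k) (f : N → M) (x : N) :
    (α.pullback f).toModel x = (α.toModel (f x)).compContinuousLinearMap (mderiv f x) := rfl

lemma DiffForm.inChart_eq {k : ℕ} (α : DiffForm M k) (p : M) (y : R8) :
    α.inChart p y = (α.toModel ((extChartAt 𝓘(ℝ, R8) p).symm y)).compContinuousLinearMap
      (mderiv (extChartAt 𝓘(ℝ, R8) p).symm y) := rfl

lemma DiffForm.d_toModel {k : ℕ} (α : DiffForm M k) (p : M) :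
    α.d.toModel p = (extDeriv (α.inChart p) (extChartAt 𝓘(ℝ, R8) p p)).compContinuousLinearMap
      (mderiv (extChartAt 𝓘(ℝ, R8) p) p) := rfl

end Derivative

section Group

variable {G : Type*} [TopologicalSpace G] [ChartedSpace R8 G] [Group G] [LieGroup 𝓘(ℝ, R8) ∞ G]

/-- The left-invariant vector field with value `X` at the identity. -/
def leftField (X : R8) (g : G) : R8 := mderiv (g * ·) (1 : G) X

/-- The pullback of a left-invariant vector field along a local diffeomorphism. -/
def pulledField (f : R8 → G) (X : R8) (y : R8) : R8 := (mderiv f y).inverse (leftField X (f y))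

lemma mlieBracket_mulInvariantVectorField (X Y : GroupLieAlgebra 𝓘(ℝ, R8) G) :
    VectorField.mlieBracket 𝓘(ℝ, R8) (mulInvariantVectorField X) (mulInvariantVectorField Y) =
      mulInvariantVectorField (G := G) ⁅X, Y⁆ :=
  (mulInvariantVector_mlieBracket X Y).symm

/-- Pullback of vector fields respects brackets, and left-invariant fields are closed under the
bracket. -/
lemma lieBracket_pulledField {f : R8 → G} {y : R8} (hf : ContMDiffAt 𝓘(ℝ, R8) 𝓘(ℝ, R8) ∞ f y)
    (X Y : GroupLieAlgebra 𝓘(ℝ, R8) G) :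
    VectorField.lieBracket ℝ (pulledField f X) (pulledField f Y) y =
      pulledField f (⁅X, Y⁆ : GroupLieAlgebra 𝓘(ℝ, R8) G) y := by
  have h := VectorField.mpullback_mlieBracket (n := ∞)
    (mdifferentiableAt_mulInvariantVectorField X (g := f y))
    (mdifferentiableAt_mulInvariantVectorField Y) hf (by simp; exact ENat.LEInfty.out)
  rw [mlieBracket_mulInvariantVectorField] at h
  have h2 : ∀ A B : (x : R8) → TangentSpace 𝓘(ℝ, R8) x,
      VectorField.mlieBracket 𝓘(ℝ, R8) A B y = VectorField.lieBracket ℝ A B y := fun A B => by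
    have h3 := congrFun (VectorField.mlieBracketWithin_eq_lieBracketWithin (V := A) (W := B)
      (s := Set.univ)) y
    rw [VectorField.mlieBracketWithin_univ] at h3
    exact h3.trans (congrFun VectorField.lieBracketWithin_univ y)
  exact (h2 _ _).symm.trans h.symm

lemma differentiableAt_pulledField {f : R8 → G} {y : R8}
    (hf : ContMDiffAt 𝓘(ℝ, R8) 𝓘(ℝ, R8) ∞ f y) (hf' : (mderiv f y).IsInvertible)
    (X : GroupLieAlgebra 𝓘(ℝ, R8) G) : DifferentiableAt ℝ (pulledField f X) y := by
  have h := ContMDiffAt.mpullback_vectorField_preimage (m := 1) (n := ∞)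
    ((contMDiffAt_mulInvariantVectorField X (g := f y)).of_le (by simp)) hf hf' 
    (by rw [one_add_one_eq_two]; exact ENat.LEInfty.out)
  exact (contMDiffAt_vectorSpace_iff_contDiffAt.1 h).differentiableAt one_ne_zero

/-- The exterior derivative of a form with constant coefficients on left-invariant fields. -/
lemma extDeriv_pulledField {f : R8 → G} {y : R8} (hf : ContMDiffAt 𝓘(ℝ, R8) 𝓘(ℝ, R8) ∞ f y)
    (hf' : (mderiv f y).IsInvertible) {α : R8 → R8 [⋀^Fin 4]→L[ℝ] ℝ}
    (hα : DifferentiableAt ℝ α y) (Ω : GroupLieAlgebra 𝓘(ℝ, R8) G [⋀^Fin 4]→ₗ[ℝ] ℝ)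
    (h : ∀ᶠ z in 𝓝 y, ∀ X : Fin 4 → R8, α z (fun i => pulledField f (X i) z) = Ω X)
    (X : Fin 5 → GroupLieAlgebra 𝓘(ℝ, R8) G) :
    extDeriv α y (fun i => pulledField (G := G) f (X i) y) = lieDiff Ω X := by
  rw [extDeriv_apply_vectorField (V := fun i => pulledField (G := G) f (X i)) hα
    fun i => differentiableAt_pulledField hf hf' _]
  -- The form has constant values on these fields near `y`, so only the bracket terms of the
  -- invariant formula for `d` survive.
  have h0 : ∀ i : Fin 5, fderiv ℝ (fun z => α z (i.removeNth fun j =>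
      pulledField (G := G) f (X j) z)) y = 0 := fun i => by
    have : (fun z => α z (i.removeNth fun j => pulledField (G := G) f (X j) z)) =ᶠ[𝓝 y]
        fun _ => Ω (i.removeNth X) := by
      filter_upwards [h] with z hz
      exact hz (i.removeNth X)
    rw [this.fderiv_eq]
    simp
  simp only [h0]
  rw [lieDiff, sub_eq_add_neg]
  simp only [zero_apply, smul_zero, Finset.sum_const_zero, zero_add]
  congr 1
  refine Finset.sum_congr rfl fun i _ => Finset.sum_congr rfl fun j _ => ?_
  congr 1
  refine Eq.trans ?_ (h.self_of_nhds (Matrix.vecCons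
    (⁅X i.castSucc, X j.succ⁆ : GroupLieAlgebra 𝓘(ℝ, R8) G)
    (j.removeNth <| i.castSucc.removeNth X)))
  congr 1
  ext l : 1
  refine Fin.cases ?_ (fun l => rfl) l
  exact lieBracket_pulledField hf _ _

end Group
end

noncomputable section

variable {G : Type*} [TopologicalSpace G] [ChartedSpace R8 G] [Group G] [LieGroup 𝓘(ℝ, R8) ∞ G]
  {M : Type*} [TopologicalSpace M] [ChartedSpace R8 M] [IsManifold 𝓘(ℝ, R8) ∞ M]

omit [LieGroup 𝓘(ℝ, R8) ∞ G] [IsManifold 𝓘(ℝ, R8) ∞ M] in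
lemma toModel_pullback_leftField {k : ℕ} (Ω : DiffForm M k) (π : G → M)
    (hinv : ∀ a : G, (Ω.pullback π).pullback (a * ·) = Ω.pullback π) (a : G) (X : Fin k → R8) :
    (Ω.toModel (π a)) (fun i => mderiv π a (leftField (X i) a)) = (Ω.pullback π).toModel 1 X := by
  have h := congrArg (fun α => DiffForm.toModel α (1 : G)) (hinv a)
  simp only [DiffForm.pullback_toModel, mul_one] at h
  rw [DiffForm.pullback_toModel, ← h]
  rfl

omit [Group G] [LieGroup 𝓘(ℝ, R8) ∞ G] [IsManifold 𝓘(ℝ, R8) ∞ M] in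
lemma IsLocalDiffeomorphAt.isInvertible_mderiv {f : G → M} {x : G}
    (hf : IsLocalDiffeomorphAt 𝓘(ℝ, R8) 𝓘(ℝ, R8) ∞ f x) : (mderiv f x).IsInvertible :=
  ⟨hf.mfderivToContinuousLinearEquiv (by simp), rfl⟩

/-- The exterior derivative of a left-invariant form, computed on a quotient. -/
theorem toModel_d_apply {π : G → M} (hπ : IsLocalDiffeomorph 𝓘(ℝ, R8) 𝓘(ℝ, R8) ∞ π)
    {Ω : DiffForm M 4} (hΩ : Ω.IsSmooth)
    (hinv : ∀ a : G, (Ω.pullback π).pullback (a * ·) = Ω.pullback π) (x : G)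
    (X : Fin 5 → GroupLieAlgebra 𝓘(ℝ, R8) G) :
    Ω.d.toModel (π x) (fun i => mderiv π x (leftField (X i) x)) =
      lieDiff (L := GroupLieAlgebra 𝓘(ℝ, R8) G) ((Ω.pullback π).toModel 1).toAlternatingMap X := by
  set p := π x with hp
  set φ := extChartAt 𝓘(ℝ, R8) p with hφ
  set y := φ p with hy
  let σ := (hπ x).localInverse
  -- A local lift of the inverse chart: π ∘ f = φ⁻¹ near `y`. In this chart Ω therefore takes
  -- constant values on the fields pulled back along `f`.
  let f : R8 → G := σ ∘ φ.symm
  have hyt : y ∈ φ.target := mem_extChartAt_target p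
  have hφy : φ.symm y = p := extChartAt_to_inv p
  have hσx : σ p = x := (hπ x).localInverse_left_inv (hπ x).localInverse_mem_target
  have hfy : f y = x := by simp only [f, Function.comp_apply, hφy, hσx]
  have htarget : φ.target ∈ 𝓝 y := extChartAt_target_mem_nhds p
  have hsymm : ContMDiffOn 𝓘(ℝ, R8) 𝓘(ℝ, R8) ∞ φ.symm φ.target := contMDiffOn_extChartAt_symm p
  have hcont : ContinuousAt φ.symm y := continuousAt_extChartAt_symm p
  have hW : ∀ᶠ z in 𝓝 y, z ∈ φ.target ∧ φ.symm z ∈ σ.source := by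
    refine Filter.Eventually.and htarget (hcont.eventually_mem ?_)
    rw [hφy]
    exact (hπ x).localInverse_open_source.mem_nhds (hπ x).localInverse_mem_source
  have hfsm : ∀ᶠ z in 𝓝 y, ContMDiffAt 𝓘(ℝ, R8) 𝓘(ℝ, R8) ∞ f z := by
    filter_upwards [hW, eventually_mem_nhds_iff.2 htarget] with z hz hz'
    exact ContMDiffAt.comp z ((hπ x).localInverse_contMDiffOn.contMDiffAt
      ((hπ x).localInverse_open_source.mem_nhds hz.2)) (hsymm.contMDiffAt hz')
  have hπf : ∀ᶠ z in 𝓝 y, π (f z) = φ.symm z := by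
    filter_upwards [hW] with z hz
    exact (hπ x).localInverse_right_inv hz.2
  have hmdπ : ∀ g, MDifferentiableAt 𝓘(ℝ, R8) 𝓘(ℝ, R8) π g := fun g =>
    (hπ g).mdifferentiableAt (by simp)
  have hDπf : ∀ᶠ z in 𝓝 y, mderiv φ.symm z = (mderiv π (f z)).comp (mderiv f z) := by
    filter_upwards [hπf.eventually_nhds, hfsm] with z hz hz'
    rw [← mderiv_comp (hmdπ _) (hz'.mdifferentiableAt (by simp))]
    exact (mderiv_congr hz).symm
  have hDφ : ∀ᶠ z in 𝓝 y, (mderiv φ.symm z).IsInvertible := by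
    filter_upwards [htarget] with z hz
    have h := isInvertible_mfderivWithin_extChartAt_symm (I := 𝓘(ℝ, R8)) hz
    simp only [modelWithCornersSelf_coe, Set.range_id, mfderivWithin_univ] at h
    exact h
  have hDf : ∀ᶠ z in 𝓝 y, (mderiv f z).IsInvertible := by
    filter_upwards [hDπf, hDφ] with z hz hz'
    have hi := (hπ (f z)).isInvertible_mderiv
    have h : mderiv f z = (mderiv π (f z)).inverse.comp (mderiv φ.symm z) := by
      rw [hz, ← ContinuousLinearMap.comp_assoc, hi.inverse_comp_self, ContinuousLinearMap.id_comp]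
    rw [h]
    exact hi.inverse.comp hz'
  have hα : DifferentiableAt ℝ (Ω.inChart p) y :=
    ((hΩ p).contDiffAt htarget).differentiableAt (by simp)
  have hconst : ∀ᶠ z in 𝓝 y, ∀ X : Fin 4 → R8, Ω.inChart p z (fun i => pulledField f (X i) z) =
      ((Ω.pullback π).toModel 1).toAlternatingMap X := by
    filter_upwards [hDπf, hDf, hπf] with z hz hz' hz'' X
    rw [DiffForm.inChart_eq, hz]
    change Ω.toModel (φ.symm z) (fun i => mderiv π (f z) (mderiv f z (pulledField f (X i) z))) = _
    have h : ∀ i, mderiv f z (pulledField f (X i) z) = leftField (X i) (f z) := fun i => by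
      rw [pulledField, hz'.self_apply_inverse]
    simp only [h, ← hz'']
    exact toModel_pullback_leftField Ω π hinv (f z) X
  rw [← extDeriv_pulledField hfsm.self_of_nhds hDf.self_of_nhds hα
    (G := G) ((Ω.pullback π).toModel 1).toAlternatingMap hconst X, DiffForm.d_toModel]
  change extDeriv (Ω.inChart p) y (fun i => mderiv φ p (mderiv π x (leftField (X i) x))) = _
  congr 1
  ext1 i
  have hi := hDf.self_of_nhds
  -- The two vectors are compared after applying the derivative of `f` and then that of π, both
  -- injective.
  refine hi.injective ?_
  change _ = mderiv f y ((mderiv f y).inverse (leftField (X i) (f y)))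
  rw [hi.self_apply_inverse, hfy]
  have h1 : mderiv φ.symm y (mderiv φ p (mderiv π x (leftField (X i) x))) =
      mderiv π x (leftField (X i) x) := by
    have h := mfderivWithin_extChartAt_symm_comp_mfderiv_extChartAt' (I := 𝓘(ℝ, R8))
      (mem_extChartAt_source p)
    simp only [modelWithCornersSelf_coe, Set.range_id, mfderivWithin_univ] at h
    exact DFunLike.congr_fun h (mderiv π x (leftField (X i) x))
  rw [hDπf.self_of_nhds, hfy] at h1
  exact (hπ x).isInvertible_mderiv.injective h1
end

/-! ### Transport of the structure to the Lie algebra. -/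

noncomputable section

variable {G : Type*} [TopologicalSpace G] [ChartedSpace R8 G] [Group G] [LieGroup 𝓘(ℝ, R8) ∞ G]
  {M : Type*} [TopologicalSpace M] [ChartedSpace R8 M] [IsManifold 𝓘(ℝ, R8) ∞ M]

lemma mdifferentiableAt_leftMul (a x : G) :
    MDifferentiableAt 𝓘(ℝ, R8) 𝓘(ℝ, R8) (a * ·) x :=
  (contMDiff_mul_left (I := 𝓘(ℝ, R8)) (n := ∞)).mdifferentiableAt (by simp)

lemma mdifferentiableAt_rightMul (a x : G) :
    MDifferentiableAt 𝓘(ℝ, R8) 𝓘(ℝ, R8) (· * a) x :=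
  (contMDiff_mul_right (I := 𝓘(ℝ, R8)) (n := ∞)).mdifferentiableAt (by simp)

lemma mderiv_mul_left_comp (a b x : G) :
    (mderiv (a * ·) (b * x)).comp (mderiv (b * ·) x) = mderiv (a * b * ·) x := by
  rw [← mderiv_comp (mdifferentiableAt_leftMul a (b * x)) (mdifferentiableAt_leftMul b x)]
  congr 1
  ext y
  simp [mul_assoc]

lemma isInvertible_mderiv_mul_left (a x : G) : (mderiv (a * ·) x).IsInvertible := by
  have h : ∀ a x : G, (mderiv (a⁻¹ * ·) (a * x)).comp (mderiv (a * ·) x) =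
      ContinuousLinearMap.id ℝ R8 := fun a x => by
    rw [mderiv_mul_left_comp, ← mderiv_id x]
    congr 1
    ext y
    simp
  refine ContinuousLinearMap.IsInvertible.of_inverse (g := mderiv (a⁻¹ * ·) (a * x)) ?_ (h a x)
  have h' := h a⁻¹ (a * x)
  rwa [inv_inv, inv_mul_cancel_left] at h'

omit [IsManifold 𝓘(ℝ, R8) ∞ M] in
lemma exists_leftTrivialization {π : G → M} (hπ : IsLocalDiffeomorph 𝓘(ℝ, R8) 𝓘(ℝ, R8) ∞ π)
    (x : G) : ∃ P : GroupLieAlgebra 𝓘(ℝ, R8) G ≃ₗ[ℝ] TangentSpace 𝓘(ℝ, R8) (π x),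
      ∀ X, P X = mderiv π x (leftField (G := G) X x) := by
  obtain ⟨P, hP⟩ := (hπ x).isInvertible_mderiv.comp (isInvertible_mderiv_mul_left x 1)
  exact ⟨P.toLinearEquiv, fun X => DFunLike.congr_fun hP X⟩

section Transport

variable {V W : Type*} [AddCommGroup V] [Module ℝ V] [AddCommGroup W] [Module ℝ W]

lemma cayleyForm_map (e : Module.Basis (Fin 8) ℝ V) (P : V ≃ₗ[ℝ] W) (v : Fin 4 → V) :
    cayleyForm (e.map P) (fun i => P (v i)) = cayleyForm e v := by
  simp [cayleyForm, wedge4]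

lemma hodgeStar5_map (e : Module.Basis (Fin 8) ℝ V) (P : V ≃ₗ[ℝ] W) (β : (Fin 5 → W) → ℝ)
    (v : Fin 3 → V) :
    hodgeStar5 (e.map P) β (fun i => P (v i)) = hodgeStar5 e (fun u => β fun i => P (u i)) v := by
  simp only [hodgeStar5, Module.Basis.map_apply, Module.Basis.det_map]
  refine Finset.sum_congr rfl fun s _ => ?_
  congr 2
  ext i : 1
  refine Fin.addCases (m := 5) (n := 3) (fun i => ?_) (fun i => ?_) i <;> simp

end Transport

/-- At each point, left translation followed by dπ identifies the Lie algebra with the tangent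
space. Under it the form, its differential, the Cayley frame and the vector `w` become the data of
`hodgeStar5_lieDiff_eq_zero`. -/
theorem Spin7Structure.isParallel_of_isLocallyConformallyParallel {π : G → M}
    (hπ : IsLocalDiffeomorph 𝓘(ℝ, R8) 𝓘(ℝ, R8) ∞ π) (hsurj : Function.Surjective π)
    (hG : IsQuasiAbelian (GroupLieAlgebra 𝓘(ℝ, R8) G))
    (htr : ∀ X : GroupLieAlgebra 𝓘(ℝ, R8) G,
      LinearMap.trace ℝ _ (LieAlgebra.ad ℝ (GroupLieAlgebra 𝓘(ℝ, R8) G) X) = 0)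
    (S : Spin7Structure M) (hS : S.IsInvariant π) (hlcp : S.IsLocallyConformallyParallel) :
    S.IsParallel := by
  intro p e he v
  obtain ⟨x, rfl⟩ := hsurj p
  obtain ⟨P, hP⟩ := exists_leftTrivialization hπ x
  obtain ⟨w, hw⟩ := hlcp _ e he
  obtain ⟨e', rfl⟩ : ∃ e' : Module.Basis (Fin 8) ℝ (GroupLieAlgebra 𝓘(ℝ, R8) G), e'.map P = e :=
    ⟨e.map P.symm, by ext i : 1; simp⟩
  obtain ⟨w, rfl⟩ := P.surjective w
  obtain ⟨v, rfl⟩ : ∃ v' : Fin 3 → GroupLieAlgebra 𝓘(ℝ, R8) G, (fun i => P (v' i)) = v :=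
    ⟨fun i => P.symm (v i), by ext i : 1; simp⟩
  let Ω : GroupLieAlgebra 𝓘(ℝ, R8) G [⋀^Fin 4]→ₗ[ℝ] ℝ :=
    ((S.form.pullback π).toModel 1).toAlternatingMap
  have hform : ∀ u : Fin 4 → GroupLieAlgebra 𝓘(ℝ, R8) G,
      S.form (π x) (fun i => P (u i)) = Ω u := fun u => by
    simp only [hP]
    exact toModel_pullback_leftField S.form π hS.2 x u
  have hd : (fun u : Fin 5 → GroupLieAlgebra 𝓘(ℝ, R8) G =>
      S.form.d (π x) (fun i => P (u i))) = lieDiff Ω := by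
    funext u
    simp only [hP]
    exact toModel_d_apply hπ S.smooth_form hS.2 x u
  rw [hodgeStar5_map, hd]
  refine hodgeStar5_lieDiff_eq_zero hG htr e' Ω (fun u => ?_) w (fun u => ?_) v
  · rw [← hform, he.2, cayleyForm_map]
  · rw [← hd, ← hodgeStar5_map, hw, ← hform]
    congr 1
    ext i : 1
    refine Fin.cases rfl (fun i => rfl) i
end

/-! ### Jacobi's formula, the adjoint representation and invariant frames. -/

noncomputable section

section Det

lemma hasFDerivAt_det_one_apply {n : ℕ} (H : Fin n → Fin n → ℝ) :
    fderiv ℝ (fun m : Fin n → Fin n → ℝ => Matrix.det (Matrix.of m))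
      (fun i j => (1 : Matrix (Fin n) (Fin n) ℝ) i j) H = Matrix.trace (Matrix.of H) := by
  set f := fun m : Fin n → Fin n → ℝ => Matrix.det (Matrix.of m) with hf
  set o : Fin n → Fin n → ℝ := fun i j => (1 : Matrix (Fin n) (Fin n) ℝ) i j with ho
  have hd : DifferentiableAt ℝ f o := by
    simp only [hf, Matrix.det_apply, Matrix.of_apply]
    fun_prop
  have h1 : HasDerivAt (fun t : ℝ => f (o + t • H)) (fderiv ℝ f o H) 0 := by
    have hl : HasDerivAt (fun t : ℝ => o + t • H) H 0 := by
      simpa using ((hasDerivAt_id (0 : ℝ)).smul_const H).const_add o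
    have h0 : o = o + (0 : ℝ) • H := by simp
    have hd' : HasFDerivAt f (fderiv ℝ f o) (o + (0 : ℝ) • H) := by
      rw [← h0]
      exact hd.hasFDerivAt
    exact hd'.comp_hasDerivAt (0 : ℝ) hl
  have h2 : HasDerivAt (fun t : ℝ => f (o + t • H)) (Matrix.trace (Matrix.of H)) 0 := by
    -- det(1 + tH) = 1 + t tr H + t² q(t) with q a polynomial.
    have he : (fun t : ℝ => f (o + t • H)) = fun t =>
        1 + Matrix.trace (Matrix.of H) * t +
          (Matrix.det (1 + (Polynomial.X : Polynomial ℝ) •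
            (Matrix.of H).map Polynomial.C)).divX.divX.eval t * t ^ 2 := by
      funext t
      exact Matrix.det_one_add_smul t (Matrix.of H)
    rw [he]
    set q := (Matrix.det (1 + (Polynomial.X : Polynomial ℝ) •
            (Matrix.of H).map Polynomial.C)).divX.divX
    have h3 := (((hasDerivAt_id (0 : ℝ)).const_mul (Matrix.trace (Matrix.of H))).const_add 1).add
      ((q.hasDerivAt 0).mul (hasDerivAt_pow 2 (0 : ℝ)))
    exact h3.congr_deriv (by simp)
  exact h1.unique h2

/-- Jacobi's formula at the identity. -/
lemma fderiv_det_apply {E : Type*} [NormedAddCommGroup E] [NormedSpace ℝ E]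
    {F : E → R8 →L[ℝ] R8} {z : E} (hF : DifferentiableAt ℝ F z)
    (hz : F z = ContinuousLinearMap.id ℝ R8) (X : E) :
    DifferentiableAt ℝ (fun y => LinearMap.det (F y : R8 →ₗ[ℝ] R8)) z ∧
    fderiv ℝ (fun y => LinearMap.det (F y : R8 →ₗ[ℝ] R8)) z X =
      LinearMap.trace ℝ R8 (fderiv ℝ F z X : R8 →ₗ[ℝ] R8) := by
  let b : Module.Basis (Fin 8) ℝ R8 := (EuclideanSpace.basisFun (Fin 8) ℝ).toBasis
  let L : (R8 →L[ℝ] R8) →L[ℝ] (Fin 8 → Fin 8 → ℝ) :=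
    ContinuousLinearMap.pi fun i => ContinuousLinearMap.pi fun j =>
      (EuclideanSpace.proj i).comp (ContinuousLinearMap.apply ℝ R8 (b j))
  have hL : ∀ A : R8 →L[ℝ] R8, Matrix.of (L A) = LinearMap.toMatrix b b (A : R8 →ₗ[ℝ] R8) :=
    fun A => by
      ext i j
      simp [L, b, LinearMap.toMatrix_apply]
  have h1 : (fun y => LinearMap.det (F y : R8 →ₗ[ℝ] R8)) =
      (fun m : Fin 8 → Fin 8 → ℝ => Matrix.det (Matrix.of m)) ∘ fun y => L (F y) := by
    funext y
    rw [Function.comp_apply, hL, LinearMap.det_toMatrix]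
  have h2 : L (F z) = fun i j => (1 : Matrix (Fin 8) (Fin 8) ℝ) i j := by
    have := hL (F z)
    rw [hz] at this
    have h3 : LinearMap.toMatrix b b ((ContinuousLinearMap.id ℝ R8 : R8 →L[ℝ] R8) : R8 →ₗ[ℝ] R8)
      = 1 := LinearMap.toMatrix_id b
    rw [h3] at this
    rw [hz]
    exact this
  have hdet : Differentiable ℝ (fun m : Fin 8 → Fin 8 → ℝ => Matrix.det (Matrix.of m)) := by
    simp only [Matrix.det_apply, Matrix.of_apply]
    fun_prop
  have hLF : DifferentiableAt ℝ (fun y => L (F y)) z := L.differentiableAt.comp z hF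
  rw [h1]
  refine ⟨(hdet _).comp z hLF, ?_⟩
  rw [fderiv_comp z (hdet _) hLF, ContinuousLinearMap.comp_apply, h2, hasFDerivAt_det_one_apply,
    LinearMap.trace_eq_matrix_trace ℝ b, ← hL]
  congr 2
  have h4 : HasFDerivAt (fun y => L (F y)) (L.comp (fderiv ℝ F z)) z :=
    L.hasFDerivAt.comp z hF.hasFDerivAt
  rw [h4.fderiv]
  rfl

end Det

section Adjoint

variable {G : Type*} [TopologicalSpace G] [ChartedSpace R8 G] [Group G] [LieGroup 𝓘(ℝ, R8) ∞ G]

/-- The adjoint representation. -/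
def adjoint (g : G) : R8 →L[ℝ] R8 := mderiv (fun y => g * y * g⁻¹) (1 : G)

/-- The left-invariant frame, in the chart at the identity. -/
def leftFrame (x : G) : R8 →L[ℝ] R8 :=
  (mderiv (extChartAt 𝓘(ℝ, R8) (1 : G)) x).comp (mderiv (x * ·) (1 : G))

/-- The right-invariant frame, in the chart at the identity. -/
def rightFrame (x : G) : R8 →L[ℝ] R8 :=
  (mderiv (extChartAt 𝓘(ℝ, R8) (1 : G)) x).comp (mderiv (· * x) (1 : G))

lemma mdifferentiableAt_conj (g x : G) :
    MDifferentiableAt 𝓘(ℝ, R8) 𝓘(ℝ, R8) (fun y => g * y * g⁻¹) x :=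
  (mdifferentiableAt_rightMul g⁻¹ (g * x)).comp x (mdifferentiableAt_leftMul g x)

/-- The derivative at y = 1 of xy = (xyx⁻¹)x. -/
lemma leftFrame_eq (x : G) : leftFrame x = (rightFrame x).comp (adjoint x) := by
  rw [leftFrame, rightFrame, ContinuousLinearMap.comp_assoc]
  congr 1
  have h := mderiv_comp (f := fun y : G => x * y * x⁻¹) (g := fun y : G => y * x) (x := 1)
    (mdifferentiableAt_rightMul x _) (mdifferentiableAt_conj x 1)
  rw [mul_one, mul_inv_cancel] at h
  rw [adjoint, ← h]
  congr 1
  ext y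
  simp

/-- The multiplication in the chart at the identity. -/
def chartMul (G : Type*) [TopologicalSpace G] [ChartedSpace R8 G] [Group G] (p : R8 × R8) : R8 :=
  extChartAt 𝓘(ℝ, R8) (1 : G) ((extChartAt 𝓘(ℝ, R8) (1 : G)).symm p.1 *
    (extChartAt 𝓘(ℝ, R8) (1 : G)).symm p.2)

variable (G)

/-- The coordinates of the identity. -/
def chartOne : R8 := extChartAt 𝓘(ℝ, R8) (1 : G) 1

variable {G}

omit [LieGroup 𝓘(ℝ, R8) ∞ G] in
lemma extChartAt_symm_chartOne : (extChartAt 𝓘(ℝ, R8) (1 : G)).symm (chartOne G) = 1 :=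
  extChartAt_to_inv 1

lemma contDiffAt_chartMul : ContDiffAt ℝ ∞ (chartMul G) (chartOne G, chartOne G) := by
  have hsymm : ContMDiffAt 𝓘(ℝ, R8) 𝓘(ℝ, R8) ∞ (extChartAt 𝓘(ℝ, R8) (1 : G)).symm (chartOne G) :=
    (contMDiffOn_extChartAt_symm (1 : G)).contMDiffAt (extChartAt_target_mem_nhds (1 : G))
  have h1 : ContMDiffAt 𝓘(ℝ, R8 × R8) 𝓘(ℝ, R8) ∞ (Prod.fst : R8 × R8 → R8)
    (chartOne G, chartOne G) := contDiff_fst.contMDiff.contMDiffAt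
  have h2 : ContMDiffAt 𝓘(ℝ, R8 × R8) 𝓘(ℝ, R8) ∞ (Prod.snd : R8 × R8 → R8)
    (chartOne G, chartOne G) := contDiff_snd.contMDiff.contMDiffAt
  have h3 := (ContMDiffAt.comp (chartOne G, chartOne G) (hsymm) h1).mul
    (ContMDiffAt.comp (chartOne G, chartOne G) (hsymm) h2)
  have h4 : ContMDiffAt 𝓘(ℝ, R8) 𝓘(ℝ, R8) ∞ (extChartAt 𝓘(ℝ, R8) (1 : G)) 1 :=
    contMDiffAt_extChartAt
  refine ContMDiffAt.contDiffAt (ContMDiffAt.comp (chartOne G, chartOne G) ?_ h3)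
  have h5 : (extChartAt 𝓘(ℝ, R8) (1 : G)).symm (chartOne G) *
      (extChartAt 𝓘(ℝ, R8) (1 : G)).symm (chartOne G) = 1 := by
    rw [extChartAt_symm_chartOne, mul_one]
  have h6 : ∀ g : G, g = 1 →
      ContMDiffAt 𝓘(ℝ, R8) 𝓘(ℝ, R8) ∞ (extChartAt 𝓘(ℝ, R8) (1 : G)) g := by
    rintro g rfl
    exact h4
  exact h6 _ h5

lemma mderiv_extChartAt_symm_chartOne :
    mderiv (extChartAt 𝓘(ℝ, R8) (1 : G)).symm (chartOne G) = ContinuousLinearMap.id ℝ R8 := by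
  have h := mfderivWithin_range_extChartAt_symm (I := 𝓘(ℝ, R8)) (x := (1 : G))
  simp only [modelWithCornersSelf_coe, Set.range_id, mfderivWithin_univ] at h
  exact h

omit [LieGroup 𝓘(ℝ, R8) ∞ G] in
lemma eventually_mem_source : ∀ᶠ z in 𝓝 (chartOne G),
    (extChartAt 𝓘(ℝ, R8) (1 : G)).symm z ∈ (extChartAt 𝓘(ℝ, R8) (1 : G)).source := by
  filter_upwards [extChartAt_target_mem_nhds (I := 𝓘(ℝ, R8)) (1 : G)] with z hz
  exact (extChartAt 𝓘(ℝ, R8) (1 : G)).map_target hz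

lemma mdifferentiableAt_extChartAt_symm_chartOne :
    MDifferentiableAt 𝓘(ℝ, R8) 𝓘(ℝ, R8) (extChartAt 𝓘(ℝ, R8) (1 : G)).symm (chartOne G) :=
  ((contMDiffOn_extChartAt_symm (n := ∞) (1 : G)).contMDiffAt
    (extChartAt_target_mem_nhds (1 : G))).mdifferentiableAt (by simp)

lemma mdifferentiableAt_extChartAt_of_mem {x : G} (hx : x ∈ (extChartAt 𝓘(ℝ, R8) (1 : G)).source) :
    MDifferentiableAt 𝓘(ℝ, R8) 𝓘(ℝ, R8) (extChartAt 𝓘(ℝ, R8) (1 : G)) x :=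
  mdifferentiableAt_extChartAt (by rwa [extChartAt_source] at hx)

/-- The inverse chart has identity derivative at the base point, so only the outer chart
contributes. This exhibits the frames as partial derivatives of the multiplication. -/
lemma fderiv_chart_comp {f : G → G} {x : G} (hf : MDifferentiableAt 𝓘(ℝ, R8) 𝓘(ℝ, R8) f 1)
    (hx : f 1 = x) (hmem : x ∈ (extChartAt 𝓘(ℝ, R8) (1 : G)).source) :
    fderiv ℝ (fun z => extChartAt 𝓘(ℝ, R8) (1 : G) (f ((extChartAt 𝓘(ℝ, R8) (1 : G)).symm z)))
      (chartOne G) = (mderiv (extChartAt 𝓘(ℝ, R8) (1 : G)) x).comp (mderiv f 1) := by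
  subst hx
  have h1 := mdifferentiableAt_extChartAt_symm_chartOne (G := G)
  have hf' : MDifferentiableAt 𝓘(ℝ, R8) 𝓘(ℝ, R8) f
      ((extChartAt 𝓘(ℝ, R8) (1 : G)).symm (chartOne G)) := by
    rwa [extChartAt_symm_chartOne]
  have hφ : MDifferentiableAt 𝓘(ℝ, R8) 𝓘(ℝ, R8) (extChartAt 𝓘(ℝ, R8) (1 : G))
      ((f ∘ (extChartAt 𝓘(ℝ, R8) (1 : G)).symm) (chartOne G)) := by
    rw [Function.comp_apply, extChartAt_symm_chartOne]
    exact mdifferentiableAt_extChartAt_of_mem hmem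
  have h2 := mderiv_comp hφ (hf'.comp _ h1)
  rw [mderiv_comp hf' h1, mderiv_extChartAt_symm_chartOne, Function.comp_apply,
    extChartAt_symm_chartOne, ContinuousLinearMap.comp_id] at h2
  rw [← h2, mderiv_eq_fderiv]
  rfl

lemma leftFrame_extChartAt_symm {z : R8}
    (hz : (extChartAt 𝓘(ℝ, R8) (1 : G)).symm z ∈ (extChartAt 𝓘(ℝ, R8) (1 : G)).source) :
    leftFrame ((extChartAt 𝓘(ℝ, R8) (1 : G)).symm z) =
      fderiv ℝ (fun y => chartMul G (z, y)) (chartOne G) :=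
  (fderiv_chart_comp (mdifferentiableAt_leftMul _ 1) (mul_one _) hz).symm

lemma rightFrame_extChartAt_symm {z : R8}
    (hz : (extChartAt 𝓘(ℝ, R8) (1 : G)).symm z ∈ (extChartAt 𝓘(ℝ, R8) (1 : G)).source) :
    rightFrame ((extChartAt 𝓘(ℝ, R8) (1 : G)).symm z) =
      fderiv ℝ (fun y => chartMul G (y, z)) (chartOne G) :=
  (fderiv_chart_comp (mdifferentiableAt_rightMul _ 1) (one_mul _) hz).symm

end Adjoint
end

/-! ### Second derivatives of the multiplication and the trace of ad. -/

noncomputable section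

section Calculus

variable {E F : Type*} [NormedAddCommGroup E] [NormedSpace ℝ E]
  [NormedAddCommGroup F] [NormedSpace ℝ F] {m : E × E → F} {z : E}

lemma fderiv_partial_right (hm : ContDiffAt ℝ ∞ m (z, z)) :
    ∀ᶠ x in 𝓝 z, fderiv ℝ (fun y => m (x, y)) z =
      (fderiv ℝ m (x, z)).comp (ContinuousLinearMap.inr ℝ E E) := by
  have h : ∀ᶠ p in 𝓝 (z, z), DifferentiableAt ℝ m p := by
    filter_upwards [(hm.of_le (m := 1) (by exact ENat.LEInfty.out)).eventually (by simp)] with p hp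
    exact hp.differentiableAt one_ne_zero
  have hc : Filter.Tendsto (fun x => (x, z)) (𝓝 z) (𝓝 (z, z)) :=
    (Continuous.prodMk_left z).tendsto z
  filter_upwards [hc.eventually h] with x hx
  exact (hx.hasFDerivAt.comp z (hasFDerivAt_prodMk_right x z)).fderiv

lemma fderiv_partial_left (hm : ContDiffAt ℝ ∞ m (z, z)) :
    ∀ᶠ x in 𝓝 z, fderiv ℝ (fun y => m (y, x)) z =
      (fderiv ℝ m (z, x)).comp (ContinuousLinearMap.inl ℝ E E) := by
  have h : ∀ᶠ p in 𝓝 (z, z), DifferentiableAt ℝ m p := by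
    filter_upwards [(hm.of_le (m := 1) (by exact ENat.LEInfty.out)).eventually (by simp)] with p hp
    exact hp.differentiableAt one_ne_zero
  have hc : Filter.Tendsto (fun x => (z, x)) (𝓝 z) (𝓝 (z, z)) :=
    (Continuous.prodMk_right z).tendsto z
  filter_upwards [hc.eventually h] with x hx
  exact (hx.hasFDerivAt.comp z (hasFDerivAt_prodMk_left z x)).fderiv

lemma differentiableAt_fderiv_of_contDiffAt (hm : ContDiffAt ℝ ∞ m (z, z)) :
    DifferentiableAt ℝ (fderiv ℝ m) (z, z) :=
  (hm.fderiv_right (m := 1)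
    (by rw [one_add_one_eq_two]; exact ENat.LEInfty.out)).differentiableAt one_ne_zero

lemma hasFDerivAt_fderiv_partial_right (hm : ContDiffAt ℝ ∞ m (z, z)) :
    HasFDerivAt (fun x => fderiv ℝ (fun y => m (x, y)) z)
      (((ContinuousLinearMap.compL ℝ E (E × E) F).flip (ContinuousLinearMap.inr ℝ E E)).comp
        ((fderiv ℝ (fderiv ℝ m) (z, z)).comp (ContinuousLinearMap.inl ℝ E E))) z := by
  refine HasFDerivAt.congr_of_eventuallyEq ?_ (fderiv_partial_right hm)
  have h1 : HasFDerivAt (fun x => fderiv ℝ m (x, z))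
      ((fderiv ℝ (fderiv ℝ m) (z, z)).comp (ContinuousLinearMap.inl ℝ E E)) z :=
    HasFDerivAt.comp (f := fun x : E => (x, z)) z
      (differentiableAt_fderiv_of_contDiffAt hm).hasFDerivAt (hasFDerivAt_prodMk_left z z)
  exact ((ContinuousLinearMap.compL ℝ E (E × E) F).flip
    (ContinuousLinearMap.inr ℝ E E)).hasFDerivAt.comp z h1

lemma hasFDerivAt_fderiv_partial_left (hm : ContDiffAt ℝ ∞ m (z, z)) :
    HasFDerivAt (fun x => fderiv ℝ (fun y => m (y, x)) z)
      (((ContinuousLinearMap.compL ℝ E (E × E) F).flip (ContinuousLinearMap.inl ℝ E E)).comp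
        ((fderiv ℝ (fderiv ℝ m) (z, z)).comp (ContinuousLinearMap.inr ℝ E E))) z := by
  refine HasFDerivAt.congr_of_eventuallyEq ?_ (fderiv_partial_left hm)
  have h1 : HasFDerivAt (fun x => fderiv ℝ m (z, x))
      ((fderiv ℝ (fderiv ℝ m) (z, z)).comp (ContinuousLinearMap.inr ℝ E E)) z :=
    (differentiableAt_fderiv_of_contDiffAt hm).hasFDerivAt.comp z (hasFDerivAt_prodMk_right z z)
  exact ((ContinuousLinearMap.compL ℝ E (E × E) F).flip
    (ContinuousLinearMap.inl ℝ E E)).hasFDerivAt.comp z h1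

/-- Symmetry of the second derivative of `m` on the vectors (0, X) and (Y, 0). It trades a
derivative of the left frame for one of the right frame. -/
lemma fderiv_fderiv_partial_symm (hm : ContDiffAt ℝ ∞ m (z, z)) (X Y : E) :
    fderiv ℝ (fun x => fderiv ℝ (fun y => m (y, x)) z) z X Y =
      fderiv ℝ (fun x => fderiv ℝ (fun y => m (x, y)) z) z Y X := by
  rw [(hasFDerivAt_fderiv_partial_left hm).fderiv, (hasFDerivAt_fderiv_partial_right hm).fderiv]
  exact (hm.isSymmSndFDerivAt (by simp; exact ENat.LEInfty.out)) (0, X) (Y, 0)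

end Calculus

section Trace

variable {G : Type*} [TopologicalSpace G] [ChartedSpace R8 G] [Group G] [LieGroup 𝓘(ℝ, R8) ∞ G]

/-- The left-invariant frame as a function of the coordinates at the identity. -/
lemma leftFrame_eventuallyEq : ∀ᶠ z in 𝓝 (chartOne G),
    leftFrame ((extChartAt 𝓘(ℝ, R8) (1 : G)).symm z) =
      fderiv ℝ (fun y => chartMul G (z, y)) (chartOne G) := by
  filter_upwards [eventually_mem_source (G := G)] with z hz
  exact leftFrame_extChartAt_symm hz

lemma rightFrame_eventuallyEq : ∀ᶠ z in 𝓝 (chartOne G),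
    rightFrame ((extChartAt 𝓘(ℝ, R8) (1 : G)).symm z) =
      fderiv ℝ (fun y => chartMul G (y, z)) (chartOne G) := by
  filter_upwards [eventually_mem_source (G := G)] with z hz
  exact rightFrame_extChartAt_symm hz

lemma pulledField_eventuallyEq (X : R8) : ∀ᶠ z in 𝓝 (chartOne G),
    pulledField (extChartAt 𝓘(ℝ, R8) (1 : G)).symm X z =
      leftFrame ((extChartAt 𝓘(ℝ, R8) (1 : G)).symm z) X := by
  filter_upwards [extChartAt_target_mem_nhds (I := 𝓘(ℝ, R8)) (1 : G)] with z hz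
  have h1 := mfderiv_extChartAt_comp_mfderivWithin_extChartAt_symm hz
  have h2 := mfderivWithin_extChartAt_symm_comp_mfderiv_extChartAt hz
  simp only [modelWithCornersSelf_coe, Set.range_id, mfderivWithin_univ] at h1 h2
  have h3 : (mderiv (extChartAt 𝓘(ℝ, R8) (1 : G)).symm z).inverse =
      mderiv (extChartAt 𝓘(ℝ, R8) (1 : G)) ((extChartAt 𝓘(ℝ, R8) (1 : G)).symm z) :=
    ContinuousLinearMap.inverse_eq h2 h1
  rw [pulledField, h3]
  rfl

lemma leftFrame_one : leftFrame (1 : G) = ContinuousLinearMap.id ℝ R8 := by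
  have h1 : mderiv (extChartAt 𝓘(ℝ, R8) (1 : G)) (1 : G) = ContinuousLinearMap.id ℝ R8 :=
    mfderiv_extChartAt_self
  have h2 : mderiv ((1 : G) * ·) (1 : G) = ContinuousLinearMap.id ℝ R8 := by
    rw [← mderiv_id (1 : G)]
    congr 1
    ext y
    simp
  rw [leftFrame, h1, h2, ContinuousLinearMap.comp_id]

lemma rightFrame_one : rightFrame (1 : G) = ContinuousLinearMap.id ℝ R8 := by
  have h1 : mderiv (extChartAt 𝓘(ℝ, R8) (1 : G)) (1 : G) = ContinuousLinearMap.id ℝ R8 :=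
    mfderiv_extChartAt_self
  have h2 : mderiv (· * (1 : G)) (1 : G) = ContinuousLinearMap.id ℝ R8 := by
    rw [← mderiv_id (1 : G)]
    congr 1
    ext y
    simp
  rw [rightFrame, h1, h2, ContinuousLinearMap.comp_id]

/-- The Lie bracket, in terms of the derivatives of the invariant frames. -/
lemma bracket_eq_fderiv (X Y : GroupLieAlgebra 𝓘(ℝ, R8) G) :
    (⁅X, Y⁆ : GroupLieAlgebra 𝓘(ℝ, R8) G) =
      fderiv ℝ (fun z => fderiv ℝ (fun y => chartMul G (z, y)) (chartOne G)) (chartOne G) X Y -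
      fderiv ℝ (fun z => fderiv ℝ (fun y => chartMul G (y, z)) (chartOne G)) (chartOne G) X Y := by
  have hsymm : ContMDiffAt 𝓘(ℝ, R8) 𝓘(ℝ, R8) ∞ (extChartAt 𝓘(ℝ, R8) (1 : G)).symm (chartOne G) :=
    (contMDiffOn_extChartAt_symm (1 : G)).contMDiffAt (extChartAt_target_mem_nhds (1 : G))
  have hV : ∀ X : R8, pulledField (extChartAt 𝓘(ℝ, R8) (1 : G)).symm X =ᶠ[𝓝 (chartOne G)]
      fun z => fderiv ℝ (fun y => chartMul G (z, y)) (chartOne G) X := fun X => by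
    filter_upwards [pulledField_eventuallyEq X, leftFrame_eventuallyEq (G := G)] with z h1 h2
    rw [h1, h2]
  have h0 : ∀ X : R8, pulledField (extChartAt 𝓘(ℝ, R8) (1 : G)).symm X (chartOne G) = X :=
    fun X => by
      rw [(pulledField_eventuallyEq X).self_of_nhds, extChartAt_symm_chartOne, leftFrame_one]
      rfl
  have hm := contDiffAt_chartMul (G := G)
  have hd : ∀ X Y : R8, fderiv ℝ (fun z => fderiv ℝ (fun y => chartMul G (z, y)) (chartOne G) X)
      (chartOne G) Y =
      fderiv ℝ (fun z => fderiv ℝ (fun y => chartMul G (z, y)) (chartOne G)) (chartOne G) Y X :=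
    fun X Y => by
      have h := (hasFDerivAt_fderiv_partial_right hm).differentiableAt
      rw [fderiv_clm_apply h (differentiableAt_const X)]
      simp
  have hb := lieBracket_pulledField hsymm X Y
  -- The bracket is the derivative of the left frame in direction X applied to Y, minus the same
  -- with X and Y exchanged; symmetry rewrites the second term by the right frame.
  have key : ∀ X Y : R8, VectorField.lieBracket ℝ
      (pulledField (extChartAt 𝓘(ℝ, R8) (1 : G)).symm X)
      (pulledField (extChartAt 𝓘(ℝ, R8) (1 : G)).symm Y) (chartOne G) =
      fderiv ℝ (fun z => fderiv ℝ (fun y => chartMul G (z, y)) (chartOne G)) (chartOne G) X Y -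
      fderiv ℝ (fun z => fderiv ℝ (fun y => chartMul G (y, z)) (chartOne G)) (chartOne G) X Y :=
    fun X Y => by
      rw [VectorField.lieBracket, (hV X).fderiv_eq, (hV Y).fderiv_eq, h0, h0, hd, hd,
        fderiv_fderiv_partial_symm hm]
  exact (hb.trans (h0 _)).symm.trans (key X Y)

/-- If the adjoint representation has determinant `±1`, then the adjoint representation of the
Lie algebra is trace-free. -/
theorem trace_ad_eq_zero (hdet : ∀ g : G, |LinearMap.det (adjoint g : R8 →ₗ[ℝ] R8)| = 1)
    (X : GroupLieAlgebra 𝓘(ℝ, R8) G) :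
    LinearMap.trace ℝ _ (LieAlgebra.ad ℝ (GroupLieAlgebra 𝓘(ℝ, R8) G) X) = 0 := by
  set L : R8 → R8 →L[ℝ] R8 := fun z => fderiv ℝ (fun y => chartMul G (z, y)) (chartOne G) with hL
  set R : R8 → R8 →L[ℝ] R8 := fun z => fderiv ℝ (fun y => chartMul G (y, z)) (chartOne G) with hR
  have hm := contDiffAt_chartMul (G := G)
  have hL1 : L (chartOne G) = ContinuousLinearMap.id ℝ R8 := by
    rw [← leftFrame_one (G := G), ← extChartAt_symm_chartOne (G := G)]
    exact leftFrame_eventuallyEq.self_of_nhds.symm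
  have hR1 : R (chartOne G) = ContinuousLinearMap.id ℝ R8 := by
    rw [← rightFrame_one (G := G), ← extChartAt_symm_chartOne (G := G)]
    exact rightFrame_eventuallyEq.self_of_nhds.symm
  -- The left frame is the right frame composed with Ad. Squaring removes the sign left open by |det
  -- Ad| = 1.
  have hsq : (fun z => LinearMap.det (L z : R8 →ₗ[ℝ] R8) ^ 2) =ᶠ[𝓝 (chartOne G)]
      fun z => LinearMap.det (R z : R8 →ₗ[ℝ] R8) ^ 2 := by
    have hdc : ∀ A B : R8 →L[ℝ] R8, LinearMap.det ((A.comp B : R8 →L[ℝ] R8) : R8 →ₗ[ℝ] R8) =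
        LinearMap.det (A : R8 →ₗ[ℝ] R8) * LinearMap.det (B : R8 →ₗ[ℝ] R8) :=
      fun A B => LinearMap.det_comp _ _
    filter_upwards [leftFrame_eventuallyEq (G := G), rightFrame_eventuallyEq (G := G)] with z h1 h2
    rw [hL, hR]
    simp only
    rw [← h1, ← h2, leftFrame_eq, hdc, mul_pow,
      ← sq_abs (LinearMap.det (adjoint _ : R8 →ₗ[ℝ] R8)), hdet, one_pow, mul_one]
  -- Both determinants are 1 at the identity, so the squares have derivatives 2 tr dL(X) and 2 tr
  -- dR(X) there.
  have key : ∀ X : R8, LinearMap.trace ℝ R8 (fderiv ℝ L (chartOne G) X : R8 →ₗ[ℝ] R8) -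
      LinearMap.trace ℝ R8 (fderiv ℝ R (chartOne G) X : R8 →ₗ[ℝ] R8) = 0 := fun X => by
    obtain ⟨hLd, hLt⟩ :=
      fderiv_det_apply (hasFDerivAt_fderiv_partial_right hm).differentiableAt hL1 X
    obtain ⟨hRd, hRt⟩ :=
      fderiv_det_apply (hasFDerivAt_fderiv_partial_left hm).differentiableAt hR1 X
    have h := DFunLike.congr_fun (hsq.fderiv_eq (𝕜 := ℝ)) X
    have hLdet : LinearMap.det (L (chartOne G) : R8 →ₗ[ℝ] R8) = 1 := by
      rw [hL1]; exact LinearMap.det_id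
    have hRdet : LinearMap.det (R (chartOne G) : R8 →ₗ[ℝ] R8) = 1 := by
      rw [hR1]; exact LinearMap.det_id
    rw [(hLd.hasFDerivAt.pow 2).fderiv, (hRd.hasFDerivAt.pow 2).fderiv] at h
    rw [← hLt, ← hRt]
    simp only [hL] at hLdet
    simp only [hR] at hRdet
    simp only [hLdet, hRdet] at h
    simpa [sub_eq_zero] using h
  have had : LieAlgebra.ad ℝ (GroupLieAlgebra 𝓘(ℝ, R8) G) X =
      (((fderiv ℝ L (chartOne G) (X : R8) : R8 →L[ℝ] R8) : R8 →ₗ[ℝ] R8) -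
        ((fderiv ℝ R (chartOne G) (X : R8) : R8 →L[ℝ] R8) : R8 →ₗ[ℝ] R8)) := by
    ext Y
    exact bracket_eq_fderiv X Y
  rw [had]
  exact (map_sub (LinearMap.trace ℝ R8) _ _).trans (key X)

end Trace
end

/-! ### The left-invariant volume in a chart. -/

noncomputable section

section ChartMeasure

open MeasureTheory

variable {G : Type*} [TopologicalSpace G] [ChartedSpace R8 G] [Group G] [LieGroup 𝓘(ℝ, R8) ∞ G]

lemma det_comp (A B : R8 →L[ℝ] R8) : (A.comp B).det = A.det * B.det :=
  LinearMap.det_comp _ _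

lemma det_leftFrame_ne_zero {x : G} (hx : x ∈ (extChartAt 𝓘(ℝ, R8) (1 : G)).source) :
    (leftFrame x).det ≠ 0 := by
  have : IsManifold 𝓘(ℝ, R8) 1 G := IsManifold.of_le (n := ∞) (by exact ENat.LEInfty.out)
  have h1 : (mderiv (extChartAt 𝓘(ℝ, R8) (1 : G)) x).IsInvertible :=
    isInvertible_mfderiv_extChartAt hx
  obtain ⟨e, he⟩ := h1.comp (isInvertible_mderiv_mul_left x 1)
  rw [leftFrame, ← he]
  exact (LinearEquiv.isUnit_det' e.toLinearEquiv).ne_zero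

/-- The derivative at y = 1 of h(xy)g = (hxg)(g⁻¹yg). -/
lemma mderiv_mul_mul_comp (h x g : G) :
    (mderiv (fun y => h * y * g) x).comp (mderiv (x * ·) (1 : G)) =
      (mderiv (h * x * g * ·) (1 : G)).comp (adjoint g⁻¹) := by
  have hd : MDifferentiableAt 𝓘(ℝ, R8) 𝓘(ℝ, R8) (fun y => h * y * g) (x * 1) :=
    (mdifferentiableAt_rightMul g (h * (x * 1))).comp (x * 1) (mdifferentiableAt_leftMul h (x * 1))
  have h1 := mderiv_comp hd (mdifferentiableAt_leftMul x 1)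
  have h2 := mderiv_comp (mdifferentiableAt_leftMul (h * x * g) _) (mdifferentiableAt_conj g⁻¹ 1)
  rw [mul_one] at h1
  rw [mul_one, mul_inv_cancel] at h2
  rw [adjoint, ← h1, ← h2]
  congr 1
  ext y
  simp [mul_assoc]

/-- A translation in the chart at the identity. -/
def chartTranslation (h g : G) (z : R8) : R8 :=
  extChartAt 𝓘(ℝ, R8) (1 : G) (h * (extChartAt 𝓘(ℝ, R8) (1 : G)).symm z * g)

lemma hasFDerivAt_chartTranslation {h g x : G} (hx : x ∈ (extChartAt 𝓘(ℝ, R8) (1 : G)).source)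
    (hx' : h * x * g ∈ (extChartAt 𝓘(ℝ, R8) (1 : G)).source) :
    DifferentiableAt ℝ (chartTranslation h g) (extChartAt 𝓘(ℝ, R8) (1 : G) x) ∧
    (fderiv ℝ (chartTranslation h g) (extChartAt 𝓘(ℝ, R8) (1 : G) x)).comp (leftFrame x) =
      (leftFrame (h * x * g)).comp (adjoint g⁻¹) := by
  set φ := extChartAt 𝓘(ℝ, R8) (1 : G) with hφ
  have hz : φ x ∈ φ.target := φ.map_source hx
  have hinv : φ.symm (φ x) = x := φ.left_inv hx
  have hs : MDifferentiableAt 𝓘(ℝ, R8) 𝓘(ℝ, R8) φ.symm (φ x) :=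
    ((contMDiffOn_extChartAt_symm (n := ∞) (1 : G)).contMDiffAt
      ((isOpen_extChartAt_target (1 : G)).mem_nhds hz)).mdifferentiableAt (by simp)
  have hd : MDifferentiableAt 𝓘(ℝ, R8) 𝓘(ℝ, R8) (fun y => h * y * g) (φ.symm (φ x)) :=
    (mdifferentiableAt_rightMul g _).comp _ (mdifferentiableAt_leftMul h _)
  have hc : MDifferentiableAt 𝓘(ℝ, R8) 𝓘(ℝ, R8) φ
      (((fun y => h * y * g) ∘ φ.symm) (φ x)) := by
    rw [Function.comp_apply, hinv]
    exact mdifferentiableAt_extChartAt_of_mem hx'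
  have h1 := mderiv_comp hc (hd.comp _ hs)
  have hT : chartTranslation h g = φ ∘ ((fun y => h * y * g) ∘ φ.symm) := rfl
  rw [mderiv_comp hd hs, Function.comp_apply, hinv] at h1
  refine ⟨?_, ?_⟩
  · rw [hT]
    exact (hc.comp _ (hd.comp _ hs)).differentiableAt
  have h2 : (mderiv φ.symm (φ x)).comp (mderiv φ x) = ContinuousLinearMap.id ℝ R8 := by
    have h3 := mfderivWithin_extChartAt_symm_comp_mfderiv_extChartAt' hx
    simp only [modelWithCornersSelf_coe, Set.range_id, mfderivWithin_univ] at h3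
    exact h3
  rw [← mderiv_eq_fderiv, hT, h1, leftFrame, leftFrame, ContinuousLinearMap.comp_assoc,
    ContinuousLinearMap.comp_assoc, ContinuousLinearMap.comp_assoc, ← mderiv_mul_mul_comp]
  congr 2
  rw [← ContinuousLinearMap.comp_assoc, h2, ContinuousLinearMap.id_comp]

variable (G) in
/-- The density of the left-invariant volume in the chart at the identity. -/
def chartDensity (z : R8) : ENNReal :=
  ENNReal.ofReal |(leftFrame ((extChartAt 𝓘(ℝ, R8) (1 : G)).symm z)).det|⁻¹

variable [MeasurableSpace G] [BorelSpace G]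

variable (G) in
/-- The left-invariant volume on the domain of the chart at the identity. -/
def chartMeasure : Measure G :=
  Measure.map (extChartAt 𝓘(ℝ, R8) (1 : G)).symm
    ((volume.restrict (extChartAt 𝓘(ℝ, R8) (1 : G)).target).withDensity (chartDensity G))

omit [LieGroup 𝓘(ℝ, R8) ∞ G] in
lemma measurableSet_chart_image {B : Set G} (hB : MeasurableSet B)
    (hBs : B ⊆ (extChartAt 𝓘(ℝ, R8) (1 : G)).source) :
    MeasurableSet (extChartAt 𝓘(ℝ, R8) (1 : G) '' B) := by
  have h := (extChartAt 𝓘(ℝ, R8) (1 : G)).image_eq_target_inter_inv_preimage hBs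
  have hc : Continuous fun z : (extChartAt 𝓘(ℝ, R8) (1 : G)).target =>
      (extChartAt 𝓘(ℝ, R8) (1 : G)).symm z :=
    continuousOn_iff_continuous_domRestrict.1 (continuousOn_extChartAt_symm (1 : G))
  have h2 := MeasurableSet.subtype_image (isOpen_extChartAt_target (1 : G)).measurableSet
    (hc.measurable hB)
  rw [h]
  convert h2 using 1
  ext z
  simp [and_comm]

omit [LieGroup 𝓘(ℝ, R8) ∞ G] in
lemma chartMeasure_apply {B : Set G} (hB : MeasurableSet B)
    (hBs : B ⊆ (extChartAt 𝓘(ℝ, R8) (1 : G)).source) :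
    chartMeasure G B = ∫⁻ z in extChartAt 𝓘(ℝ, R8) (1 : G) '' B, chartDensity G z := by
  have ho : MeasurableSet (extChartAt 𝓘(ℝ, R8) (1 : G)).target :=
    (isOpen_extChartAt_target (1 : G)).measurableSet
  have hm : AEMeasurable (extChartAt 𝓘(ℝ, R8) (1 : G)).symm
      (volume.restrict (extChartAt 𝓘(ℝ, R8) (1 : G)).target) :=
    (continuousOn_extChartAt_symm (1 : G)).aemeasurable ho
  rw [chartMeasure, Measure.map_apply_of_aemeasurable
      (hm.mono_ac (withDensity_absolutelyContinuous _ _)) hB, withDensity_apply',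
    Measure.restrict_restrict' ho, Set.inter_comm,
    (extChartAt 𝓘(ℝ, R8) (1 : G)).image_eq_target_inter_inv_preimage hBs]

/-- The behaviour of the left-invariant volume under translations. -/
lemma chartMeasure_translate (h g : G) {B D : Set G} (hB : MeasurableSet B) (hD : MeasurableSet D)
    (hBs : B ⊆ (extChartAt 𝓘(ℝ, R8) (1 : G)).source)
    (hDs : D ⊆ (extChartAt 𝓘(ℝ, R8) (1 : G)).source) (hBD : ∀ x, h * x * g ∈ D ↔ x ∈ B) :
    chartMeasure G D = ENNReal.ofReal |(adjoint g⁻¹).det| * chartMeasure G B := by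
  rw [chartMeasure_apply hB hBs, chartMeasure_apply hD hDs]
  set φ := extChartAt 𝓘(ℝ, R8) (1 : G) with hφ
  have him : φ '' D = chartTranslation h g '' (φ '' B) := by
    ext z
    simp only [Set.mem_image, exists_exists_and_eq_and]
    constructor
    · rintro ⟨y, hy, rfl⟩
      have hy' : h * (h⁻¹ * y * g⁻¹) * g = y := by group
      have hx : h⁻¹ * y * g⁻¹ ∈ B := by rwa [← hBD, hy']
      refine ⟨_, hx, ?_⟩
      rw [chartTranslation, φ.left_inv (hBs hx), hy']
    · rintro ⟨x, hx, rfl⟩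
      exact ⟨_, (hBD x).2 hx, by rw [chartTranslation, φ.left_inv (hBs hx)]⟩
  have hinj : Set.InjOn (chartTranslation h g) (φ '' B) := by
    rintro _ ⟨x, hx, rfl⟩ _ ⟨y, hy, rfl⟩ hxy
    rw [chartTranslation, chartTranslation, φ.left_inv (hBs hx), φ.left_inv (hBs hy)] at hxy
    have h1 := φ.injOn (hDs ((hBD x).2 hx)) (hDs ((hBD y).2 hy)) hxy
    rw [mul_left_injective g |>.eq_iff, mul_right_injective h |>.eq_iff] at h1
    rw [h1]
  have hder : ∀ z ∈ φ '' B, HasFDerivWithinAt (chartTranslation h g)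
      (fderiv ℝ (chartTranslation h g) z) (φ '' B) z := by
    rintro _ ⟨x, hx, rfl⟩
    exact (hasFDerivAt_chartTranslation (hBs hx)
      (hDs ((hBD x).2 hx))).1.hasFDerivAt.hasFDerivWithinAt
  rw [him, lintegral_image_eq_lintegral_abs_det_fderiv_mul volume
    (measurableSet_chart_image hB hBs) hder hinj,
    ← lintegral_const_mul' _ _ ENNReal.ofReal_ne_top]
  refine setLIntegral_congr_fun (measurableSet_chart_image hB hBs) ?_
  rintro _ ⟨x, hx, rfl⟩
  have hx1 := hBs hx
  have hx2 := hDs ((hBD x).2 hx)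
  -- The Jacobian of the translation times the density at hxg equals |det Ad(g⁻¹)| times the density
  -- at x.
  have hdet := congrArg ContinuousLinearMap.det (hasFDerivAt_chartTranslation hx1 hx2).2
  rw [det_comp, det_comp] at hdet
  have h1 := abs_ne_zero.2 (det_leftFrame_ne_zero hx1)
  have h2 := abs_ne_zero.2 (det_leftFrame_ne_zero hx2)
  have hdet' := congrArg abs hdet
  rw [abs_mul, abs_mul] at hdet'
  simp only [chartDensity, chartTranslation]
  rw [← hφ, φ.left_inv hx1, φ.left_inv hx2, ← ENNReal.ofReal_mul (abs_nonneg _),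
    ← ENNReal.ofReal_mul (abs_nonneg _)]
  congr 1
  field_simp
  linarith

end ChartMeasure
end

/-! ### Gluing the left-invariant volume over the group. -/

noncomputable section

section InvariantMeasure

open MeasureTheory

variable {G : Type*} [TopologicalSpace G] [ChartedSpace R8 G] [Group G] [LieGroup 𝓘(ℝ, R8) ∞ G]

/-- The density is continuous near the identity with value 1 there. The bounds give a neighbourhood
of finite non-zero volume. -/
lemma eventually_chartDensity_mem :
    ∀ᶠ z in 𝓝 (chartOne G), 2⁻¹ ≤ chartDensity G z ∧ chartDensity G z ≤ 2 := by
  have hc : ContinuousAt (fun z => ENNReal.ofReal |(fderiv ℝ (fun y => chartMul G (z, y))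
      (chartOne G)).det|⁻¹) (chartOne G) := by
    have h1 := (hasFDerivAt_fderiv_partial_right (contDiffAt_chartMul (G := G))).continuousAt
    have h2 := ContinuousLinearMap.continuous_det.continuousAt.comp h1
    refine ENNReal.continuous_ofReal.continuousAt.comp (ContinuousAt.inv₀ h2.abs ?_)
    rw [← leftFrame_eventuallyEq.self_of_nhds, extChartAt_symm_chartOne,
      leftFrame_one]
    exact abs_ne_zero.2 ((LinearMap.det_id (M := R8) (A := ℝ)).trans_ne one_ne_zero)
  have h1 : ENNReal.ofReal |(fderiv ℝ (fun y => chartMul G (chartOne G, y))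
      (chartOne G)).det|⁻¹ = 1 := by
    rw [← leftFrame_eventuallyEq.self_of_nhds, extChartAt_symm_chartOne, leftFrame_one]
    have : (ContinuousLinearMap.id ℝ R8).det = 1 := LinearMap.det_id
    rw [this]
    simp
  have h2 := hc.tendsto
  rw [h1] at h2
  have h3 : (2⁻¹ : ENNReal) < 1 := by simp
  have h4 : (1 : ENNReal) < 2 := by simp
  filter_upwards [h2.eventually_const_le h3, h2.eventually_le_const h4,
    leftFrame_eventuallyEq (G := G)] with z hz1 hz2 hz3
  rw [chartDensity, hz3]
  exact ⟨hz1, hz2⟩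

variable [MeasurableSpace G] [BorelSpace G]

lemma exists_chartMeasure_ne_zero :
    ∃ V : Set G, IsOpen V ∧ 1 ∈ V ∧ V ⊆ (extChartAt 𝓘(ℝ, R8) (1 : G)).source ∧
      chartMeasure G V ≠ 0 ∧ chartMeasure G V ≠ ⊤ := by
  set φ := extChartAt 𝓘(ℝ, R8) (1 : G) with hφ
  obtain ⟨r, hr, hball⟩ := Metric.eventually_nhds_iff_ball.1
    (eventually_chartDensity_mem.and (extChartAt_target_mem_nhds (I := 𝓘(ℝ, R8)) (1 : G)))
  set V := φ.source ∩ φ ⁻¹' Metric.ball (chartOne G) r with hV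
  have hVo : IsOpen V := isOpen_extChartAt_preimage' (1 : G) Metric.isOpen_ball
  have hVs : V ⊆ φ.source := Set.inter_subset_left
  have him : φ '' V = Metric.ball (chartOne G) r := by
    ext z
    constructor
    · rintro ⟨x, hx, rfl⟩
      exact hx.2
    · intro hz
      have ht := (hball z hz).2
      exact ⟨φ.symm z, ⟨φ.map_target ht, by rwa [Set.mem_preimage, φ.right_inv ht]⟩,
        φ.right_inv ht⟩
  refine ⟨V, hVo, ⟨mem_extChartAt_source 1, Metric.mem_ball_self hr⟩, hVs, ?_, ?_⟩ <;>
    rw [chartMeasure_apply hVo.measurableSet hVs, him]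
  · have h1 : ∫⁻ _ in Metric.ball (chartOne G) r, (2⁻¹ : ENNReal) ≤
        ∫⁻ z in Metric.ball (chartOne G) r, chartDensity G z :=
      setLIntegral_mono' measurableSet_ball fun z hz => (hball z hz).1.1
    rw [setLIntegral_const] at h1
    refine (lt_of_lt_of_le ?_ h1).ne'
    exact ENNReal.mul_pos (by simp) (Metric.measure_ball_pos volume _ hr).ne'
  · have h1 : ∫⁻ z in Metric.ball (chartOne G) r, chartDensity G z ≤
        ∫⁻ _ in Metric.ball (chartOne G) r, (2 : ENNReal) :=
      setLIntegral_mono' measurableSet_ball fun z hz => (hball z hz).1.2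
    rw [setLIntegral_const] at h1
    exact (lt_of_le_of_lt h1 (ENNReal.mul_lt_top (by simp) measure_ball_lt_top)).ne

omit [LieGroup 𝓘(ℝ, R8) ∞ G] [MeasurableSpace G] [BorelSpace G] in
lemma det_adjoint_one : (adjoint (1 : G)).det = 1 := by
  have h : adjoint (1 : G) = ContinuousLinearMap.id ℝ R8 := by
    rw [adjoint, ← mderiv_id (1 : G)]
    congr 1
    ext y
    simp
  rw [h]
  exact LinearMap.det_id

variable [IsTopologicalGroup G] [SecondCountableTopology G]

variable (G) in
/-- The left-invariant volume. -/
lemma exists_invariantMeasure : ∃ ν : Measure G,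
    ∀ (p : G) (B : Set G), MeasurableSet B →
      (∀ x ∈ B, p⁻¹ * x ∈ (extChartAt 𝓘(ℝ, R8) (1 : G)).source) →
      ν B = chartMeasure G ((p * ·) ⁻¹' B) := by
  set U := (extChartAt 𝓘(ℝ, R8) (1 : G)).source with hU
  have hUo : IsOpen U := isOpen_extChartAt_source (1 : G)
  have hn : ∀ q : G, {x | q⁻¹ * x ∈ U} ∈ 𝓝 q := fun q => by
    refine (hUo.preimage (continuous_const_mul q⁻¹)).mem_nhds ?_
    rw [Set.mem_preimage, inv_mul_cancel]
    exact mem_extChartAt_source 1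
  obtain ⟨s, hs, hcov⟩ := TopologicalSpace.countable_cover_nhds hn
  obtain ⟨q, hq⟩ := hs.exists_eq_range (by
    rw [Set.nonempty_iff_ne_empty]
    rintro rfl
    simp at hcov
    exact (Set.univ_nonempty (α := G)).ne_empty hcov.symm)
  subst hq
  rw [Set.biUnion_range] at hcov
  have hAm : ∀ i, MeasurableSet (disjointed (fun i => {x | (q i)⁻¹ * x ∈ U}) i) :=
    MeasurableSet.disjointed fun i =>
      (hUo.preimage (continuous_const_mul (q i)⁻¹)).measurableSet
  have hAd := disjoint_disjointed (fun i => {x | (q i)⁻¹ * x ∈ U})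
  have hAu := iUnion_disjointed (f := fun i => {x | (q i)⁻¹ * x ∈ U})
  have hAs : ∀ i x, x ∈ disjointed (fun i => {x | (q i)⁻¹ * x ∈ U}) i → (q i)⁻¹ * x ∈ U :=
    fun i x hx => disjointed_subset _ i hx
  rw [hcov] at hAu
  set A := disjointed (fun i => {x | (q i)⁻¹ * x ∈ U}) with hA
  -- On each piece of a countable disjoint cover, the chart volume is translated there from the
  -- identity.
  refine ⟨Measure.sum fun i => ((chartMeasure G).map (q i * ·)).restrict (A i),
    fun p B hB hBp => ?_⟩
  rw [Measure.sum_apply _ hB]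
  have hterm : ∀ i, ((chartMeasure G).map (q i * ·)).restrict (A i) B =
      chartMeasure G ((p * ·) ⁻¹' (B ∩ A i)) := fun i => by
    have hBA := hB.inter (hAm i)
    rw [Measure.restrict_apply hB, Measure.map_apply (measurable_const_mul _) hBA]
    -- The choice of centre does not matter: changing it is a left translation, whose factor is |det
    -- Ad(1)| = 1.
    have h := chartMeasure_translate ((q i)⁻¹ * p) 1 (measurable_const_mul p hBA)
      (measurable_const_mul (q i) hBA) (fun x hx => inv_mul_cancel_left p x ▸ hBp _ hx.1)
      (fun x hx => inv_mul_cancel_left (q i) x ▸ hAs _ _ hx.2) (fun x => by simp [mul_assoc])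
    rw [h, inv_one, det_adjoint_one]
    simp
  simp_rw [hterm]
  rw [← measure_iUnion]
  · rw [← Set.preimage_iUnion, ← Set.inter_iUnion, hAu, Set.inter_univ]
  · intro i j hij
    exact Disjoint.preimage _ ((hAd hij).mono Set.inter_subset_right Set.inter_subset_right)
  · exact fun i => measurable_const_mul p (hB.inter (hAm i))

/-- The claim is local. Countably many sets `S y` cover the group, each chosen so that it and its
preimage under the translation lie in left translates of the chart domain, where
`chartMeasure_translate` applies. -/
lemma measure_translate {ν : Measure G}
    (hν : ∀ (p : G) (B : Set G), MeasurableSet B →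
      (∀ x ∈ B, p⁻¹ * x ∈ (extChartAt 𝓘(ℝ, R8) (1 : G)).source) →
      ν B = chartMeasure G ((p * ·) ⁻¹' B)) (h g : G) :
    ν = ENNReal.ofReal |(adjoint g⁻¹).det| • ν.map (fun x => h * x * g) := by
  set U := (extChartAt 𝓘(ℝ, R8) (1 : G)).source with hU
  have hUo : IsOpen U := isOpen_extChartAt_source (1 : G)
  have hτ : Continuous fun x : G => h * x * g := by fun_prop
  set S : G → Set G := fun y => {x | y⁻¹ * x ∈ U ∧ (h⁻¹ * y * g⁻¹)⁻¹ * (h⁻¹ * x * g⁻¹) ∈ U} with hS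
  have hSo : ∀ y, IsOpen (S y) := fun y =>
    (hUo.preimage (continuous_const_mul y⁻¹)).inter (hUo.preimage
      (f := fun x : G => (h⁻¹ * y * g⁻¹)⁻¹ * (h⁻¹ * x * g⁻¹)) (by fun_prop))
  have hn : ∀ y : G, S y ∈ 𝓝 y := fun y => by
    refine (hSo y).mem_nhds ⟨?_, ?_⟩ <;> rw [inv_mul_cancel] <;> exact mem_extChartAt_source 1
  obtain ⟨s, hs, hcov⟩ := TopologicalSpace.countable_cover_nhds hn
  have : Countable s := hs
  rw [Set.biUnion_eq_iUnion] at hcov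
  refine Measure.ext_of_iUnion_eq_univ hcov fun y => Measure.ext fun B hB => ?_
  have hC : MeasurableSet (B ∩ S y) := hB.inter (hSo y).measurableSet
  rw [Measure.restrict_apply hB, Measure.restrict_apply hB, Measure.smul_apply,
    Measure.map_apply hτ.measurable hC, smul_eq_mul, hν y _ hC fun x hx => hx.2.1,
    hν (h⁻¹ * y * g⁻¹) _ (hτ.measurable hC) fun x hx => ?_]
  · refine chartMeasure_translate ((y : G)⁻¹ * h * (h⁻¹ * y * g⁻¹)) g
      (measurable_const_mul _ (hτ.measurable hC)) (measurable_const_mul _ hC)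
      (fun x hx => ?_) (fun x hx => inv_mul_cancel_left (y : G) x ▸ hx.2.1) fun x => ?_
    · have := hx.2.2
      convert this using 1
      group
    · simp [mul_assoc]
  · have := hx.2.2
    convert this using 1
    group

end InvariantMeasure
end

/-! ### Fundamental domains and unimodularity. -/

noncomputable section

section FundamentalDomain

open MeasureTheory

/-- Compactness leaves finitely many sets `W`. From each in turn only the points whose image is not
yet covered are added; the covered image is open, so measurability persists. -/
lemma exists_measurable_section {X M : Type*} [TopologicalSpace X] [MeasurableSpace X]
    [BorelSpace X] [TopologicalSpace M] [CompactSpace M] {π : X → M} (hc : Continuous π)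
    (ho : IsOpenMap π) (hs : Function.Surjective π) {ν : Measure X}
    (hW : ∀ x, ∃ W : Set X, IsOpen W ∧ x ∈ W ∧ Set.InjOn π W ∧ ν W < ⊤) :
    ∃ F : Set X, MeasurableSet F ∧ Set.InjOn π F ∧ π '' F = Set.univ ∧ ν F < ⊤ := by
  choose W hWo hxW hWi hWν using hW
  obtain ⟨t, ht⟩ := isCompact_univ.elim_finite_subcover (fun x => π '' W x)
    (fun x => ho _ (hWo x)) fun y _ => by
      obtain ⟨x, rfl⟩ := hs y
      exact Set.mem_iUnion.2 ⟨x, x, hxW x, rfl⟩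
  have key : ∀ t : Finset X, ∃ F : Set X, MeasurableSet F ∧ Set.InjOn π F ∧
      π '' F = ⋃ x ∈ t, π '' W x ∧ ν F < ⊤ := by
    classical
    intro t
    induction t using Finset.induction_on with
    | empty => exact ⟨∅, MeasurableSet.empty, by simp, by simp, by simp⟩
    | insert a t _ ih =>
      obtain ⟨F, hFm, hFi, hFu, hFν⟩ := ih
      have hop : IsOpen (π '' F) := by
        rw [hFu]
        exact isOpen_biUnion fun x _ => ho _ (hWo x)
      refine ⟨F ∪ (W a \ π ⁻¹' (π '' F)),
        hFm.union ((hWo a).measurableSet.diff (hop.preimage hc).measurableSet), ?_, ?_,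
        (measure_union_le _ _).trans_lt (ENNReal.add_lt_top.2
          ⟨hFν, (measure_mono Set.sdiff_subset).trans_lt (hWν a)⟩)⟩
      · rintro x (hx | hx) y (hy | hy) hxy
        · exact hFi hx hy hxy
        · exact absurd ⟨x, hx, hxy⟩ hy.2
        · exact absurd ⟨y, hy, hxy.symm⟩ hx.2
        · exact hWi a hx.1 hy.1 hxy
      · rw [Finset.set_biUnion_insert, ← hFu]
        ext y
        constructor
        · rintro ⟨x, hx | hx, rfl⟩
          · exact Or.inr ⟨x, hx, rfl⟩
          · exact Or.inl ⟨x, hx.1, rfl⟩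
        · rintro (⟨x, hx, rfl⟩ | ⟨x, hx, rfl⟩)
          · by_cases h : π x ∈ π '' F
            · obtain ⟨z, hz, hzx⟩ := h
              exact ⟨z, Or.inl hz, hzx⟩
            · exact ⟨x, Or.inr ⟨hx, h⟩, rfl⟩
          · exact ⟨x, Or.inl hx, rfl⟩
  obtain ⟨F, hFm, hFi, hFu, hFν⟩ := key t
  exact ⟨F, hFm, hFi, by rw [hFu]; exact Set.eq_univ_of_univ_subset ht, hFν⟩

lemma IsLocalDiffeomorph.exists_injOn {G M : Type*} [TopologicalSpace G] [ChartedSpace R8 G]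
    [TopologicalSpace M] [ChartedSpace R8 M] {π : G → M}
    (hπ : IsLocalDiffeomorph 𝓘(ℝ, R8) 𝓘(ℝ, R8) ∞ π) (x : G) :
    ∃ W : Set G, IsOpen W ∧ x ∈ W ∧ Set.InjOn π W := by
  obtain ⟨Φ, hx, hΦ⟩ := hπ x
  exact ⟨Φ.source, Φ.open_source, hx, Φ.toPartialEquiv.injOn.congr hΦ.symm⟩

/-- The adjoint representation of a Lie group with a cocompact discrete subgroup has
determinant `±1`. -/
theorem IsSolvmanifold.abs_det_adjoint_eq_one
    {G : Type*} [TopologicalSpace G] [SecondCountableTopology G]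
    [ChartedSpace R8 G] [Group G] [LieGroup 𝓘(ℝ, R8) ∞ G]
    {M : Type*} [TopologicalSpace M] [ChartedSpace R8 M] {Γ : Subgroup G} {π : G → M}
    (hM : IsSolvmanifold Γ π) (g : G) : |(adjoint g).det| = 1 := by
  let : MeasurableSpace G := borel G
  have : BorelSpace G := ⟨rfl⟩
  have : IsTopologicalGroup G := topologicalGroup_of_lieGroup 𝓘(ℝ, R8) ∞
  have := hM.compact
  have := hM.discrete
  have : Countable Γ := TopologicalSpace.separableSpace_iff_countable.1 inferInstance
  obtain ⟨ν, hν⟩ := exists_invariantMeasure G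
  have hleft : ν.IsMulLeftInvariant := ⟨fun h => by
    have := measure_translate hν h 1
    rw [inv_one, det_adjoint_one, abs_one, ENNReal.ofReal_one, one_smul] at this
    simpa using this.symm⟩
  obtain ⟨V, hVo, h1V, hVs, hV0, hVtop⟩ := exists_chartMeasure_ne_zero (G := G)
  have hνV : ν V = chartMeasure G V := by
    have := hν 1 V hVo.measurableSet fun x hx => by simpa using hVs hx
    simpa using this
  have hν0 : ν ≠ 0 := by
    rintro rfl
    exact hV0 (by rw [← hνV]; rfl)
  obtain ⟨F, hFm, hFi, hFu, hFν⟩ := exists_measurable_section (ν := ν)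
    hM.localDiffeo.contMDiff.continuous hM.localDiffeo.isOpenMap hM.surjective fun x => by
      obtain ⟨W, hWo, hxW, hWi⟩ := hM.localDiffeo.exists_injOn x
      refine ⟨W ∩ (x⁻¹ * ·) ⁻¹' V, hWo.inter (hVo.preimage (continuous_const_mul _)),
        ⟨hxW, by simpa using h1V⟩, hWi.mono Set.inter_subset_left,
        (measure_mono Set.inter_subset_right).trans_lt ?_⟩
      rw [measure_preimage_mul, hνV]
      exact hVtop.lt_top
  -- The fibres of π are the Γ-orbits, and `F` meets each exactly once.
  have hexists : ∀ x : G, ∃! γ : Γ, γ • x ∈ F := fun x => by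
    obtain ⟨f, hf, hfx⟩ : π x ∈ π '' F := hFu ▸ Set.mem_univ _
    obtain ⟨γ, hγ, rfl⟩ := (hM.fibre x f).1 hfx.symm
    refine ⟨⟨γ, hγ⟩, hf, fun δ hδ => ?_⟩
    have hδx : π ((δ : G) * x) = π x := ((hM.fibre x _).2 ⟨δ, δ.2, rfl⟩).symm
    have := hFi hδ hf (hδx.trans hfx.symm)
    exact Subtype.ext (mul_right_cancel this)
  have hF : IsFundamentalDomain Γ F ν := IsFundamentalDomain.mk' hFm.nullMeasurableSet hexists
  have hτ : Measurable fun x : G => 1 * x * g⁻¹ := by fun_prop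
  -- Right translation commutes with the left action of Γ.
  have hFg : IsFundamentalDomain Γ ((fun x : G => 1 * x * g⁻¹) ⁻¹' F) ν :=
    IsFundamentalDomain.mk' (hτ hFm).nullMeasurableSet fun x => by
      have h := hexists (1 * x * g⁻¹)
      simpa [Subgroup.smul_def, mul_assoc] using h
  have h0 := hF.measure_ne_zero hν0
  -- Two fundamental domains have equal volume; since it is finite and non-zero, the scaling factor
  -- is 1.
  have h2 : ν F = ENNReal.ofReal |(adjoint g).det| * ν F := by
    conv_lhs => rw [measure_translate hν 1 g⁻¹]
    rw [Measure.smul_apply, Measure.map_apply hτ hFm, hFg.measure_eq hF, inv_inv, smul_eq_mul]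
  have h3 : ENNReal.ofReal |(adjoint g).det| = 1 :=
    ((ENNReal.mul_left_inj h0 hFν.ne).1 ((one_mul _).trans h2)).symm
  rwa [ENNReal.ofReal_eq_one] at h3

end FundamentalDomain
end

theorem corollary7p7
    {G : Type*} [TopologicalSpace G] [T2Space G] [SecondCountableTopology G]
    [ChartedSpace R8 G] [Group G] [LieGroup 𝓘(ℝ, R8) ∞ G]
    {M : Type*} [TopologicalSpace M] [T2Space M] [SecondCountableTopology M]
    [ChartedSpace R8 M] [IsManifold 𝓘(ℝ, R8) ∞ M]
    (Γ : Subgroup G) (π : G → M) (hM : IsSolvmanifold Γ π)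
    (hG : IsQuasiAbelian (GroupLieAlgebra 𝓘(ℝ, R8) G)) :
    ¬ ∃ S : Spin7Structure M,
      S.IsInvariant π ∧ S.IsLocallyConformallyParallel ∧ ¬ S.IsParallel := by
  rintro ⟨S, hinv, hlcp, hnp⟩
  exact hnp (S.isParallel_of_isLocallyConformallyParallel hM.localDiffeo hM.surjective hG
    (trace_ad_eq_zero fun g => hM.abs_det_adjoint_eq_one g) hinv hlcp)
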